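/- All graphs are finite loopless undirected multigraphs. For a finite group $G$ with identity $1$, a connection multiset of $G$ is a finite multiset $X$ of elements of $G\setminus\{1\}$ such that, for every $x\in G$, the elements $x$ and $x^{-1}$ have the same multiplicity in $X$. The Cayley graph $\mathrm{Cay}(G,X)$ is the multigraph with vertex set $G$ in which the number of edges joining $g$ and $h$ is the multiplicity of $g^{-1}h$ in $X$; it is regular. A nowhere-zero $3$-flow in a graph is an orientation of its edges (each edge oriented separately) together with an assignment to each oriented edge of an integer $\varphi(e)$ with $0<|\varphi(e)|<3$ such that, at every vertex, the sum of $\varphi$ over the outgoing edges equals the sum of $\varphi$ over the incoming edges. A group $G$ is supersolvable if it has a series $\{1\}=G_0\le G_1\le\cdots\le G_n=G$ of normal subgroups of $G$ such that each quotient $G_i/G_{i-1}$ is cyclic. **Theorem.** Let $G$ be a finite supersolvable group whose Sylow $2$-subgroups are noncyclic, and let $X$ be a connection multiset of $G$ such that $\mathrm{Cay}(G,X)$ is connected and has valency at least four. Then $\mathrm{Cay}(G,X)$ admits a nowhere-zero $3$-flow. -/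

import Mathlib

/-! ### Multigraphs: connectedness, valency, orientations and integer flows -/

namespace Graph

/-- A multigraph is connected if it has a vertex and any two vertices are joined by a walk. -/
def IsConnected {α β : Type*} (Γ : Graph α β) : Prop :=
  Γ.vertexSet.Nonempty ∧
    ∀ u ∈ Γ.vertexSet, ∀ v ∈ Γ.vertexSet, Relation.ReflTransGen Γ.Adj u v

/-- The valency (degree) of a vertex: the number of edges incident with it, loops counted twice. -/
noncomputable def valency {α β : Type*} (Γ : Graph α β) (v : α) : ℕ :=
  (Γ.incidenceSet v).ncard + (Γ.loopSet v).ncard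

/-- `Γ` is regular of valency `k`. -/
def IsRegularOfValency {α β : Type*} (Γ : Graph α β) (k : ℕ) : Prop :=
  ∀ v ∈ Γ.vertexSet, Γ.valency v = k

/-- An orientation of a multigraph chooses, for each edge separately, which of its ends is the
tail and which is the head. -/
structure Orientation {α β : Type*} (Γ : Graph α β) where
  /-- the tail of the arc obtained from an edge -/
  tail : Γ.edgeSet → α
  /-- the head of the arc obtained from an edge -/
  head : Γ.edgeSet → α
  /-- tail and head are the two ends of the edge -/
  isLink : ∀ e : Γ.edgeSet, Γ.IsLink e (tail e) (head e)

/-- `(D, φ)` is a `k`-flow in the multigraph `Γ` with finitely many edges: the values of `φ` are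
integers of absolute value less than `k`, and at each vertex the sum of `φ` over the outgoing
arcs equals the sum of `φ` over the incoming arcs. -/
def IsFlow {α β : Type*} (Γ : Graph α β) [Finite Γ.edgeSet] (k : ℕ)
    (D : Γ.Orientation) (φ : Γ.edgeSet → ℤ) : Prop :=
  (∀ e, |φ e| < (k : ℤ)) ∧
    ∀ v ∈ Γ.vertexSet, ∑ᶠ e ∈ {e | D.tail e = v}, φ e = ∑ᶠ e ∈ {e | D.head e = v}, φ e

/-- `Γ` admits a nowhere-zero `k`-flow. -/
def AdmitsNowhereZeroFlow {α β : Type*} (Γ : Graph α β) [Finite Γ.edgeSet] (k : ℕ) : Prop :=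
  ∃ (D : Γ.Orientation) (φ : Γ.edgeSet → ℤ), Γ.IsFlow k D φ ∧ ∀ e, φ e ≠ 0

end Graph

/-! ### Connection multisets and Cayley graphs -/

/-- A connection multiset of a group `G`: a multiset of nonidentity elements in which `x` and
`x⁻¹` have the same multiplicity for every `x`. -/
structure ConnectionMultiset (G : Type*) [Group G] [DecidableEq G] where
  /-- the underlying multiset -/
  elems : Multiset G
  one_notMem : (1 : G) ∉ elems
  count_inv : ∀ x : G, elems.count x⁻¹ = elems.count x

namespace ConnectionMultiset

/-- The number of edges of the Cayley graph joining the two elements of a pair `s(g, h)`: the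
multiplicity of `g⁻¹ * h` in the connection multiset. -/
def edgeMult {G : Type*} [Group G] [DecidableEq G] (X : ConnectionMultiset G) : Sym2 G → ℕ :=
  Sym2.lift ⟨fun g h => X.elems.count (g⁻¹ * h), fun g h => by
    change X.elems.count (g⁻¹ * h) = X.elems.count (h⁻¹ * g)
    rw [← X.count_inv (g⁻¹ * h), mul_inv_rev, inv_inv]⟩

/-- The edges of the Cayley graph: for each unordered pair `{g, h}`, as many edges as the
multiplicity of `g⁻¹ * h`. -/
abbrev CayleyEdge {G : Type*} [Group G] [DecidableEq G] (X : ConnectionMultiset G) : Type _ :=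
  (p : Sym2 G) × Fin (X.edgeMult p)

/-- The Cayley graph `Cay(G, X)`, a multigraph with vertex set `G`. -/
def cayleyGraph {G : Type*} [Group G] [DecidableEq G] (X : ConnectionMultiset G) :
    Graph G X.CayleyEdge where
  vertexSet := Set.univ
  IsLink e g h := e.1 = s(g, h)
  isLink_symm _ _ := ⟨fun _ _ hl => hl.trans Sym2.eq_swap⟩
  eq_or_eq_of_isLink_of_isLink _ _ _ _ _ h₁ h₂ := by
    rcases Sym2.eq_iff.1 (h₁.symm.trans h₂) with h | h
    · exact Or.inl h.1
    · exact Or.inr h.1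
  left_mem_of_isLink _ _ _ _ := Set.mem_univ _

/-- In `Cay(G, X)` the number of edges joining `g` and `h` is the multiplicity of `g⁻¹ * h`. -/
theorem ncard_isLink {G : Type*} [Group G] [DecidableEq G] (X : ConnectionMultiset G) (g h : G) :
    {e | X.cayleyGraph.IsLink e g h}.ncard = X.elems.count (g⁻¹ * h) := by
  have hs : {e | X.cayleyGraph.IsLink e g h} =
      Set.range (fun i : Fin (X.edgeMult s(g, h)) => (⟨s(g, h), i⟩ : X.CayleyEdge)) := by
    ext ⟨p, i⟩
    constructor
    · intro hp
      change p = s(g, h) at hp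
      subst hp
      exact ⟨i, rfl⟩
    · rintro ⟨j, hj⟩
      exact (congrArg Sigma.fst hj).symm
  have hinj : Function.Injective
      (fun i : Fin (X.edgeMult s(g, h)) => (⟨s(g, h), i⟩ : X.CayleyEdge)) :=
    fun i j hij => eq_of_heq (Sigma.mk.inj hij).2
  rw [hs, ← Set.image_univ, Set.ncard_image_of_injective _ hinj, Set.ncard_univ,
    Nat.card_eq_fintype_card, Fintype.card_fin]
  rfl

end ConnectionMultiset

/-! ### Supersolvable groups -/

/-- A group is supersolvable if it has a finite series `1 = H 0 ≤ H 1 ≤ ⋯ ≤ H n = G` of normal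
subgroups of `G` with all factors `H (i + 1) / H i` cyclic. -/
def IsSupersolvableGroup (G : Type*) [Group G] : Prop :=
  ∃ (n : ℕ) (H : ℕ → Subgroup G) (_ : ∀ i, (H i).Normal), H 0 = ⊥ ∧ H n = ⊤ ∧
    ∀ i < n, H i ≤ H (i + 1) ∧ IsCyclic (H (i + 1) ⧸ (H i).subgroupOf (H (i + 1)))

/-! By Tutte's theorem it suffices to find a nowhere-zero flow modulo 3. Label the arcs at a vertex
by the elements of the multiset, each label having a reverse label. A label distinct from its
reverse forms with it a pair that carries a constant flow. Involutory labels need a sign function on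
the group that changes along their edges: two labels with a common sign function cancel, and three
add up to zero modulo 3. In a finite 2-group any two involutions have a common sign function, so
only an odd number of involutory labels causes difficulty. It then suffices to find a reverse-closed
set of labels with an odd number of involutory ones that carries a flow; the rest is paired off
(`HasFlow.extend`).

A supersolvable group has a normal 2-complement `N`, and involutions survive in the noncyclic
2-group `G ⧸ N`, from which flows pull back. There the odd blocks are three involutions with a
common sign function, an involution together with an inverse pair with a common sign function, or a
central involution together with four further labels (`HasFlow.of_central`). The last case becomes a
signing problem on a connected four-regular graph: each edge at the involution must absorb the sum
of four signs, which vanishes modulo 3 only when two of them are positive and two negative.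

If no such block exists (`HasFlow.or_exceptional`), there are exactly three involutory labels `a`,
`b`, `c`, with `c` a power of `a * b` modulo `N`, and all other labels lie in `N`. Valency at least
four supplies a label `d` in `N`. Supersolvability gives a quotient in which `d` has odd prime order
and generates a normal subgroup. There `a`, `c` and `d` trace products of a four-cycle and an odd
cycle, on which an explicit pattern balances the edges of `b` (`HasFlow.of_grid`,
`HasFlow.of_prime_order`); the roles of `a` and `b` may have to be exchanged. -/

/-- A nowhere-zero `ZMod 3`-flow on the labelled Cayley digraph with labels `s`: the arc with label
`i` leaving `g` ends in `g * x i`, and its reverse has label `σ i`. -/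
def HasFlow {G ι : Type*} [Group G] (x : ι → G) (σ : ι → ι) (s : Finset ι) : Prop :=
  ∃ f : G → ι → ZMod 3, (∀ g, ∀ i ∈ s, f g i ≠ 0) ∧
    (∀ g, ∀ i ∈ s, f (g * x i) (σ i) = -f g i) ∧ ∀ g, ∑ i ∈ s, f g i = 0

/-- `1` or `-1` in `ZMod 3`. -/
def boolSign (b : Bool) : ZMod 3 := if b then 1 else -1

@[simp] theorem boolSign_not (b : Bool) : boolSign (!b) = -boolSign b := by
  cases b <;> decide

theorem boolSign_ne_zero (b : Bool) : boolSign b ≠ 0 := by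
  cases b <;> decide

/-! ### Building blocks for flows modulo 3 -/

namespace HasFlow

variable {G ι : Type*} [Group G] {x : ι → G} {σ : ι → ι} {s t : Finset ι}

theorem union [DecidableEq ι] (hs : HasFlow x σ s) (ht : HasFlow x σ t) (hst : Disjoint s t)
    (hσs : ∀ i ∈ s, σ i ∈ s) (hσt : ∀ i ∈ t, σ i ∈ t) : HasFlow x σ (s ∪ t) := by
  obtain ⟨f, hf0, hf1, hf2⟩ := hs
  obtain ⟨f', hf0', hf1', hf2'⟩ := ht
  have hts : ∀ i ∈ t, i ∉ s := fun i hi hi' => Finset.disjoint_left.1 hst hi' hi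
  refine ⟨fun g i => if i ∈ s then f g i else f' g i, fun g i hi => ?_, fun g i hi => ?_,
    fun g => ?_⟩
  · by_cases h : i ∈ s
    · simpa [h] using hf0 g i h
    · have := (Finset.mem_union.1 hi).resolve_left h
      simpa [h] using hf0' g i this
  · by_cases h : i ∈ s
    · simpa [h, hσs i h] using hf1 g i h
    · have := (Finset.mem_union.1 hi).resolve_left h
      simpa [h, hts _ (hσt i this)] using hf1' g i this
  · rw [Finset.sum_union hst, Finset.sum_congr rfl fun i hi => if_pos hi,
      Finset.sum_congr (s₁ := t) rfl fun i hi => if_neg (hts i hi), hf2, hf2', add_zero]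

theorem empty : HasFlow x σ ∅ := ⟨fun _ _ => 0, by simp, by simp, by simp⟩

theorem of_hom {H : Type*} [Group H] (φ : G →* H) (h : HasFlow (fun i => φ (x i)) σ s) :
    HasFlow x σ s := by
  obtain ⟨f, hf0, hf1, hf2⟩ := h
  exact ⟨fun g => f (φ g), fun g => hf0 _, fun g i hi => by simpa using hf1 (φ g) i hi,
    fun g => hf2 _⟩

/-- A flow on the Cayley graph of a subgroup is spread over the cosets. -/
theorem of_subgroup (H : Subgroup G) (x' : ι → H) (hx : ∀ i ∈ s, (x' i : G) = x i)
    (h : HasFlow x' σ s) : HasFlow x σ s := by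
  obtain ⟨f, hf0, hf1, hf2⟩ := h
  have hmem : ∀ g : G, ((g : G ⧸ H).out)⁻¹ * g ∈ H := fun g =>
    QuotientGroup.leftRel_apply.1 (Quotient.exact (QuotientGroup.out_eq' (g : G ⧸ H)))
  refine ⟨fun g => f ⟨_, hmem g⟩, fun g => hf0 _, fun g i hi => ?_, fun g => hf2 _⟩
  have h1 : ((g * x i : G) : G ⧸ H) = (g : G ⧸ H) := by
    rw [← hx i hi]
    exact QuotientGroup.mk_mul_of_mem g (x' i).2
  have h2 : (⟨_, hmem (g * x i)⟩ : H) = ⟨_, hmem g⟩ * x' i := by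
    ext
    simp [h1, hx i hi, mul_assoc]
  simp only [h2]
  exact hf1 _ i hi

/-- Labels that are not their own inverses carry a flow of their own. -/
theorem of_forall_ne (hσ : ∀ i ∈ s, σ (σ i) = i) (hs : ∀ i ∈ s, σ i ∈ s)
    (hne : ∀ i ∈ s, σ i ≠ i) : HasFlow x σ s := by
  classical
  -- An injective numbering of the labels decides which member of each pair `i`, `σ i` gets `1` and
  -- which gets `-1`.
  obtain ⟨e, he⟩ : ∃ e : ι → ℕ, Set.InjOn e s := by
    refine ⟨fun i => if h : i ∈ s then s.equivFin ⟨i, h⟩ else 0, fun i hi j hj hij => ?_⟩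
    rw [Finset.mem_coe] at hi hj
    simp only [hi, hj, dif_pos] at hij
    simpa using s.equivFin.injective (Fin.ext hij)
  have key : ∀ i ∈ s, boolSign (decide (e (σ i) < e (σ (σ i)))) =
      -boolSign (decide (e i < e (σ i))) := fun i hi => by
    rw [hσ i hi, ← boolSign_not]
    congr 1
    have : e (σ i) ≠ e i := fun h => hne i hi (he (hs i hi) hi h)
    rw [← decide_not]
    exact decide_eq_decide.2 (by omega)
  refine ⟨fun _ i => boolSign (decide (e i < e (σ i))), fun _ _ _ => boolSign_ne_zero _,
    fun _ i hi => key i hi, fun _ => ?_⟩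
  refine Finset.sum_involution (fun i _ => σ i) (fun i hi => ?_) (fun i hi _ => hne i hi)
    (fun i hi => hs i hi) fun i hi => hσ i hi
  beta_reduce
  rw [key i hi, add_neg_cancel]

/-- Three labels flipped by a common sign function carry a flow. -/
theorem of_card_three (r : G → Bool) (hr : ∀ g, ∀ i ∈ s, r (g * x i) = !r g) (hs : s.card = 3) :
    HasFlow x σ s := by
  -- All three labels carry the sign of the starting vertex, so the outflow is three times a sign.
  refine ⟨fun g _ => boolSign (r g), fun _ _ _ => boolSign_ne_zero _, fun g i hi => ?_,
    fun g => ?_⟩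
  · beta_reduce
    rw [hr g i hi, boolSign_not]
  · rw [Finset.sum_const, hs, nsmul_eq_mul]
    have : ((3 : ℕ) : ZMod 3) = 0 := by decide
    rw [this, zero_mul]

/-- Two involutory labels flipped by a common sign function carry a flow. -/
theorem of_pair [DecidableEq ι] {i j : ι} (hij : i ≠ j) (hi : σ i = i) (hj : σ j = j)
    (r : G → Bool) (hri : ∀ g, r (g * x i) = !r g) (hrj : ∀ g, r (g * x j) = !r g) :
    HasFlow x σ {i, j} := by
  refine ⟨fun g k => if k = i then boolSign (r g) else -boolSign (r g), fun g k _ => ?_,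
    fun g k hk => ?_, fun g => ?_⟩
  · beta_reduce
    split_ifs
    · exact boolSign_ne_zero _
    · exact neg_ne_zero.2 (boolSign_ne_zero _)
  · rcases Finset.mem_insert.1 hk with rfl | hk
    · simp [hi, hri]
    · rw [Finset.mem_singleton] at hk
      subst hk
      simp [hj, hrj, hij.symm]
  · rw [Finset.sum_pair hij]
    simp [hij.symm]

end HasFlow

/-! ### A flow on the product of a four-cycle and an odd cycle -/

/-- The boundary pattern of the fourfold grid, by position along the odd cycle: even positions,
odd positions, the last but one position, and the last position. -/
def gridKind (n : ℕ) (j : ZMod n) : Fin 4 :=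
  if j.val + 1 = n then 3 else if j.val + 2 = n then 2 else if Even j.val then 0 else 1

/-- Values on the edges of the first perfect matching of the four-cycle. -/
def gridFst (u v : Bool) (k : Fin 4) : ZMod 3 :=
  if u = v then (if u then ![1, 1, -1, 1] k else -![1, 1, -1, 1] k)
  else if u then -![1, -1, 1, -1] k else ![1, -1, 1, -1] k

/-- Values on the edges of the second perfect matching of the four-cycle. -/
def gridSnd (u v : Bool) (k : Fin 4) : ZMod 3 :=
  if u then (if v then -![-1, -1, 1, 1] k else ![-1, -1, 1, 1] k)
  else if v then -![-1, -1, 1, 1] k else ![-1, -1, 1, 1] k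

/-- Values on the edges of the odd cycles, entering a position. -/
def gridIn (u v : Bool) (k : Fin 4) : ZMod 3 :=
  if u then (if v then ![1, 1, 1, -1] k else ![1, -1, -1, 1] k)
  else if v then ![-1, 1, 1, -1] k else ![-1, -1, -1, 1] k

/-- Values on the edges of the odd cycles, leaving a position. -/
def gridOut (u v : Bool) (k : Fin 4) : ZMod 3 :=
  if u then (if v then ![1, 1, -1, 1] k else ![-1, 1, 1, 1] k)
  else if v then ![1, -1, -1, -1] k else ![-1, -1, 1, -1] k

theorem gridFst_ne_zero : ∀ u v k, gridFst u v k ≠ 0 := by decide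

theorem gridSnd_ne_zero : ∀ u v k, gridSnd u v k ≠ 0 := by decide

theorem gridOut_ne_zero : ∀ u v k, gridOut u v k ≠ 0 := by decide

theorem gridFst_not : ∀ u v k, gridFst (!u) (!v) k = -gridFst u v k := by decide

theorem gridSnd_not : ∀ u v k, gridSnd u (!v) k = -gridSnd u v k := by decide

/-- Conservation at a vertex of the grid: the term `boolSign u` is the value on the edge that leaves
the grid. -/
theorem grid_balance : ∀ u v k,
    gridOut u v k - gridIn u v k + gridFst u v k + gridSnd u v k + boolSign u = 0 := by decide

/-- These are the transitions that occur when the kinds along an odd cycle read 0, 1, 0, 1, …, 0, 2,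
3 and then return to 0. The kinds 2 and 3 repair the parity defect of the alternating pattern. -/
theorem gridOut_eq_gridIn :
    (∀ u v, gridOut u v 0 = gridIn u v 1) ∧ (∀ u v, gridOut u v 1 = gridIn u v 0) ∧
    (∀ u v, gridOut u v 0 = gridIn u v 2) ∧ (∀ u v, gridOut u v 2 = gridIn u v 3) ∧
    (∀ u v, gridOut u v 3 = gridIn u v 0) := by decide

theorem gridOut_gridKind_pred {n : ℕ} (hn : Odd n) (h1 : n ≠ 1) (u v : Bool) (j : ZMod n) :
    gridOut u v (gridKind n (j - 1)) = gridIn u v (gridKind n j) := by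
  obtain ⟨h01, h10, h02, h23, h30⟩ := gridOut_eq_gridIn
  have h3 : 3 ≤ n := by obtain ⟨m, rfl⟩ := hn; omega
  have : NeZero n := ⟨by omega⟩
  obtain ⟨i, rfl⟩ : ∃ i, j = i + 1 := ⟨j - 1, by ring⟩
  rw [add_sub_cancel_right]
  have : Fact (1 < n) := ⟨by omega⟩
  have hi := ZMod.val_lt i
  have hv : (i + 1).val = if i.val + 1 = n then 0 else i.val + 1 := by
    rw [ZMod.val_add, ZMod.val_one]
    split_ifs with h
    · rw [h, Nat.mod_self]
    · exact Nat.mod_eq_of_lt (by omega)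
  unfold gridKind
  rw [hv]
  rw [Nat.odd_iff] at hn
  by_cases ha : i.val + 1 = n
  · have : ¬ (0 + 1 = n) := by omega
    have h' : ¬ (0 + 2 = n) := by omega
    simp [ha, h30]
    rw [if_neg (by omega), if_neg (by omega)]
  by_cases hb : i.val + 2 = n
  · have : ¬ (i.val + 2 + 1 = n) := by omega
    have h' : i.val + 1 + 1 = n := by omega
    simp only [ha, hb, if_true, if_false, h23]
  by_cases hc : i.val + 3 = n
  · have h' : ¬ i.val + 1 + 1 = n := by omega
    -- Since `n` is odd, the position before the last but one is even, hence of kind 0.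
    have he : Even i.val := by rw [Nat.even_iff]; omega
    have h'' : i.val + 1 + 2 = n := by omega
    simp only [ha, hb, h'', he, if_true, if_false, h02]
  have h' : ¬ i.val + 1 + 1 = n := by omega
  have h'' : ¬ i.val + 1 + 2 = n := by omega
  by_cases he : Even i.val
  · have ho : ¬ Even (i.val + 1) := by rw [Nat.even_add_one]; exact not_not.2 he
    simp only [ha, hb, h'', he, ho, if_true, if_false, h01]
  · have ho : Even (i.val + 1) := Nat.even_add_one.2 he
    simp only [ha, hb, h'', he, ho, if_true, if_false, h10]

namespace HasFlow

variable {G ι : Type*} [Group G] {x : ι → G} {σ : ι → ι}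

/-- A flow on three involutory labels and a pair of inverse labels. -/
theorem of_five [DecidableEq ι] {a b c d : ι} (hab : a ≠ b) (hac : a ≠ c) (hbc : b ≠ c)
    (ha : σ a = a) (hb : σ b = b) (hc : σ c = c) (hd : σ d ≠ d) (hdd : σ (σ d) = d)
    (hx : x (σ d) = (x d)⁻¹) (fa fb fc fd : G → ZMod 3)
    (fa0 : ∀ g, fa g ≠ 0) (fb0 : ∀ g, fb g ≠ 0) (fc0 : ∀ g, fc g ≠ 0) (fd0 : ∀ g, fd g ≠ 0)
    (fa1 : ∀ g, fa (g * x a) = -fa g) (fb1 : ∀ g, fb (g * x b) = -fb g)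
    (fc1 : ∀ g, fc (g * x c) = -fc g)
    (hsum : ∀ g, fd g - fd (g * (x d)⁻¹) + fa g + fc g + fb g = 0) :
    HasFlow x σ {a, b, c, d, σ d} := by
  have hda : d ≠ a := fun h => hd (h ▸ ha)
  have hdb : d ≠ b := fun h => hd (h ▸ hb)
  have hdc : d ≠ c := fun h => hd (h ▸ hc)
  have hda' : σ d ≠ a := fun h => hda (by rw [← hdd, h, ha])
  have hdb' : σ d ≠ b := fun h => hdb (by rw [← hdd, h, hb])
  have hdc' : σ d ≠ c := fun h => hdc (by rw [← hdd, h, hc])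
  let f : G → ι → ZMod 3 := fun g k => if k = a then fa g else if k = b then fb g else
    if k = c then fc g else if k = d then fd g else -fd (g * (x d)⁻¹)
  have ea : ∀ g, f g a = fa g := fun g => by simp [f]
  have eb : ∀ g, f g b = fb g := fun g => by simp [f, hab.symm]
  have ec : ∀ g, f g c = fc g := fun g => by simp [f, hac.symm, hbc.symm]
  have ed : ∀ g, f g d = fd g := fun g => by simp [f, hda, hdb, hdc]
  have ed' : ∀ g, f g (σ d) = -fd (g * (x d)⁻¹) := fun g => by
    simp [f, hda', hdb', hdc', hd]
  refine ⟨f, fun g k hk => ?_, fun g k hk => ?_, fun g => ?_⟩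
  · simp only [Finset.mem_insert, Finset.mem_singleton] at hk
    rcases hk with rfl | rfl | rfl | rfl | rfl
    · rw [ea]; exact fa0 g
    · rw [eb]; exact fb0 g
    · rw [ec]; exact fc0 g
    · rw [ed]; exact fd0 g
    · rw [ed', neg_ne_zero]; exact fd0 _
  · simp only [Finset.mem_insert, Finset.mem_singleton] at hk
    rcases hk with rfl | rfl | rfl | rfl | rfl
    · rw [ha, ea, ea, fa1]
    · rw [hb, eb, eb, fb1]
    · rw [hc, ec, ec, fc1]
    · rw [ed', ed, mul_inv_cancel_right]
    · rw [hdd, ed, ed', hx, neg_neg]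
  · rw [Finset.sum_insert (by simp [hab, hac, hda.symm, hda'.symm]),
      Finset.sum_insert (by simp [hbc, hdb.symm, hdb'.symm]),
      Finset.sum_insert (by simp [hdc.symm, hdc'.symm]), Finset.sum_pair hd.symm,
      ea, eb, ec, ed, ed', ← hsum g]
    ring

/-- Three involutory labels `a, b, c` and a pair of labels of odd order `n` carry a flow, if the
group has suitable sign functions and cyclic coordinates. -/
theorem of_grid [DecidableEq ι] {a b c d : ι} (hab : a ≠ b) (hac : a ≠ c) (hbc : b ≠ c)
    (ha : σ a = a) (hb : σ b = b) (hc : σ c = c) (hd : σ d ≠ d) (hdd : σ (σ d) = d)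
    (hx : x (σ d) = (x d)⁻¹) {n : ℕ} (hn : Odd n) (h1 : n ≠ 1)
    (χ δ : G → Bool) (J : G → ZMod n) (r : G → Bool)
    (χa : ∀ g, χ (g * x a) = !χ g) (χb : ∀ g, χ (g * x b) = !χ g) (χc : ∀ g, χ (g * x c) = χ g)
    (χd : ∀ g, χ (g * x d) = χ g)
    (δa : ∀ g, δ (g * x a) = !δ g) (δc : ∀ g, δ (g * x c) = !δ g) (δd : ∀ g, δ (g * x d) = δ g)
    (Ja : ∀ g, J (g * x a) = J g) (Jc : ∀ g, J (g * x c) = J g)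
    (Jd : ∀ g, J (g * x d) = if r g then J g + 1 else J g - 1)
    (rd : ∀ g, r (g * x d) = r g) :
    HasFlow x σ {a, b, c, d, σ d} := by
  -- In the coordinates `χ`, `δ` the labels `a` and `c` alternate around a four-cycle, while `d`
  -- moves along the odd cycle `J`. When `d` runs against the direction of `J`, the value is that of
  -- the preceding grid edge with opposite sign.
  refine of_five hab hac hbc ha hb hc hd hdd hx
    (fun g => gridFst (χ g) (δ g) (gridKind n (J g))) (fun g => boolSign (χ g))
    (fun g => gridSnd (χ g) (δ g) (gridKind n (J g)))
    (fun g => if r g then gridOut (χ g) (δ g) (gridKind n (J g)) else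
      -gridOut (χ g) (δ g) (gridKind n (J g - 1)))
    (fun g => gridFst_ne_zero _ _ _) (fun g => boolSign_ne_zero _) (fun g => gridSnd_ne_zero _ _ _)
    (fun g => ?_) (fun g => ?_) (fun g => ?_) (fun g => ?_) (fun g => ?_)
  · split_ifs
    · exact gridOut_ne_zero _ _ _
    · exact neg_ne_zero.2 (gridOut_ne_zero _ _ _)
  · simp only [χa, δa, Ja, gridFst_not]
  · simp only [χb, boolSign_not]
  · simp only [χc, δc, Jc, gridSnd_not]
  · obtain ⟨h, rfl⟩ : ∃ h, g = h * x d := ⟨g * (x d)⁻¹, by simp⟩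
    simp only [mul_inv_cancel_right, rd, χd, δd, Jd]
    have := grid_balance (χ h) (δ h)
    by_cases hr : r h
    · simp only [hr, if_true]
      have h2 := gridOut_gridKind_pred hn h1 (χ h) (δ h) (J h + 1)
      rw [add_sub_cancel_right] at h2
      rw [h2]
      exact this _
    · simp only [hr]
      have h2 := gridOut_gridKind_pred hn h1 (χ h) (δ h) (J h - 1)
      rw [← this (gridKind n (J h - 1)), ← h2]
      simp only [Bool.false_eq_true, if_false]
      ring

end HasFlow

/-! ### Coordinates along a normal cyclic subgroup -/

/-- As `D` normalizes `⟨x⟩` and meets it trivially, each element of a left coset of `⟨x⟩ D` is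
uniquely a representative times `x ^ j * d`, with `j` read modulo the order of `x`. Right
multiplication by `D` keeps `j`. Right multiplication by `x` keeps `d` and moves `j` up or down
according to whether `d` centralizes or inverts `x`. -/
theorem exists_cyclic_coordinate {G : Type*} [Group G] (x : G) (D : Subgroup G)
    (hD : ∀ d ∈ D, d * x * d⁻¹ = x ∨ d * x * d⁻¹ = x⁻¹)
    (hdisj : Disjoint (Subgroup.zpowers x) D) :
    ∃ (J : G → ZMod (orderOf x)) (r : G → Bool), (∀ g, ∀ d ∈ D, J (g * d) = J g) ∧
      (∀ g, J (g * x) = if r g then J g + 1 else J g - 1) ∧ ∀ g, r (g * x) = r g := by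
  classical
  set M := Subgroup.zpowers x with hM
  have conj : ∀ d ∈ D, ∀ j : ℤ, d * x ^ j = x ^ j * d ∨ d * x ^ j = x ^ (-j) * d := by
    intro d hd j
    have h1 : d * x ^ j = (d * x * d⁻¹) ^ j * d := by
      rw [conj_zpow, inv_mul_cancel_right]
    rcases hD d hd with h | h
    · left; rw [h1, h]
    · right; rw [h1, h, inv_zpow, zpow_neg]
  let K : Subgroup G :=
    { carrier := {k | ∃ (j : ℤ) (d : G), d ∈ D ∧ k = x ^ j * d}
      one_mem' := ⟨0, 1, D.one_mem, by simp⟩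
      mul_mem' := by
        rintro _ _ ⟨j, d, hd, rfl⟩ ⟨j', d', hd', rfl⟩
        rcases conj d hd j' with h | h
        · exact ⟨j + j', d * d', D.mul_mem hd hd', by
            rw [zpow_add, mul_assoc, ← mul_assoc d, h]; simp only [mul_assoc]⟩
        · exact ⟨j + -j', d * d', D.mul_mem hd hd', by
            rw [zpow_add, mul_assoc, ← mul_assoc d, h]; simp only [mul_assoc]⟩
      inv_mem' := by
        rintro _ ⟨j, d, hd, rfl⟩
        rw [mul_inv_rev, ← zpow_neg]
        rcases conj d⁻¹ (D.inv_mem hd) (-j) with h | h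
        · exact ⟨-j, d⁻¹, D.inv_mem hd, h⟩
        · exact ⟨_, d⁻¹, D.inv_mem hd, h⟩ }
  have hout : ∀ g : G, ∃ (j : ℤ) (d : G), d ∈ D ∧ g = (g : G ⧸ K).out * (x ^ j * d) := by
    intro g
    obtain ⟨j, d, hd, h⟩ : ((g : G ⧸ K).out)⁻¹ * g ∈ K :=
      QuotientGroup.leftRel_apply.1 (Quotient.exact (QuotientGroup.out_eq' (g : G ⧸ K)))
    exact ⟨j, d, hd, by rw [← h, mul_inv_cancel_left]⟩
  choose j d hd hg using hout
  -- Two decompositions differ by an element of `⟨x⟩ ⊓ D`, which is trivial.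
  have uniq : ∀ (g h : G) (j' : ℤ) (d' : G), d' ∈ D → (h : G ⧸ K) = g →
      h = (g : G ⧸ K).out * (x ^ j' * d') → d h = d' ∧ (j h : ZMod (orderOf x)) = j' := by
    intro g h j' d' hd' hgh hh
    have h1 : x ^ j h * d h = x ^ j' * d' := by
      have := hg h
      rw [hgh] at this
      exact mul_left_cancel (this.symm.trans hh)
    have h2 : x ^ (-j' + j h) = d' * (d h)⁻¹ := by
      rw [eq_mul_inv_iff_mul_eq, zpow_add, mul_assoc, h1, ← mul_assoc, ← zpow_add]
      simp
    have h3 : x ^ (-j' + j h) = 1 := by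
      have : x ^ (-j' + j h) ∈ M ⊓ D :=
        ⟨Subgroup.zpow_mem_zpowers _ _, h2 ▸ D.mul_mem hd' (D.inv_mem (hd h))⟩
      rwa [hdisj.eq_bot, Subgroup.mem_bot] at this
    refine ⟨?_, ?_⟩
    · rw [h3] at h2
      exact (mul_inv_eq_one.1 h2.symm).symm
    · have h4 := (orderOf_dvd_iff_zpow_eq_one).2 h3
      rw [ZMod.intCast_eq_intCast_iff, Int.modEq_iff_dvd]
      have : j' - j h = -(-j' + j h) := by ring
      rw [this]
      exact (dvd_neg).2 h4
  have hx : ∀ g, (d (g * x) = d g) ∧ (j (g * x) : ZMod (orderOf x)) =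
      if d g * x * (d g)⁻¹ = x then (j g : ZMod (orderOf x)) + 1 else j g - 1 := by
    intro g
    have hcos : ((g * x : G) : G ⧸ K) = g :=
      QuotientGroup.mk_mul_of_mem g (show x ∈ K from ⟨1, 1, D.one_mem, by simp⟩)
    by_cases h : d g * x * (d g)⁻¹ = x
    · obtain ⟨h1, h2⟩ := uniq g (g * x) (j g + 1) (d g) (hd g) hcos (by
        conv_lhs => rw [hg g]
        have : d g * x = x * d g := mul_inv_eq_iff_eq_mul.1 h
        rw [zpow_add_one]
        simp only [mul_assoc]
        rw [this])
      exact ⟨h1, by rw [h2, if_pos h]; push_cast; rfl⟩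
    · obtain ⟨h1, h2⟩ := uniq g (g * x) (j g - 1) (d g) (hd g) hcos (by
        conv_lhs => rw [hg g]
        have h' := (hD _ (hd g)).resolve_left h
        have : d g * x = x⁻¹ * d g := mul_inv_eq_iff_eq_mul.1 h'
        rw [zpow_sub_one]
        simp only [mul_assoc]
        rw [this])
      exact ⟨h1, by rw [h2, if_neg h]; push_cast; rfl⟩
  refine ⟨fun g => j g, fun g => decide (d g * x * (d g)⁻¹ = x), fun g e he => ?_, fun g => ?_,
    fun g => ?_⟩
  · refine (uniq g (g * e) (j g) (d g * e) (D.mul_mem (hd g) he)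
      (QuotientGroup.mk_mul_of_mem g (show e ∈ K from ⟨0, e, he, by simp⟩)) ?_).2
    conv_lhs => rw [hg g]
    simp only [mul_assoc]
  · simpa using (hx g).2
  · beta_reduce
    rw [(hx g).1]

/-! ### Sign functions on finite `2`-groups -/

section Sign

variable {P : Type*} [Group P]

/-- In a 2-group the proper subgroup `K` lies in a subgroup `L` of index two in `H`. The sign
records membership in `L`, carried to each left coset of `H` by a representative. -/
theorem exists_sign [Finite P] (hP : IsPGroup 2 P) {K H : Subgroup P} (h : K < H) :
    ∃ (L : Subgroup P) (s : P → Bool), K ≤ L ∧ L < H ∧ (∀ g, ∀ k ∈ L, s (g * k) = s g) ∧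
      ∀ g, ∀ k ∈ H, k ∉ L → s (g * k) = !s g := by
  classical
  have : Fact (Nat.Prime 2) := ⟨Nat.prime_two⟩
  obtain ⟨m, hm⟩ := IsPGroup.iff_card.1 (hP.to_subgroup H)
  obtain ⟨n, hn⟩ := IsPGroup.iff_card.1 (hP.to_subgroup K)
  have hcard : Nat.card (K.subgroupOf H) = 2 ^ n := by
    rw [← hn]
    exact Nat.card_congr (Subgroup.subgroupOfEquivOfLe h.le).toEquiv
  have hlt : n < m := by
    have h1 : Nat.card K ≤ Nat.card H := Nat.card_le_card_of_injective _
      (Subgroup.inclusion_injective h.le)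
    have h2 : Nat.card K ≠ Nat.card H := fun e => h.ne (Subgroup.eq_of_le_of_card_ge h.le e.ge)
    rw [hm, hn] at h1 h2
    exact (Nat.pow_lt_pow_iff_right (by norm_num)).1 (lt_of_le_of_ne h1 h2)
  obtain ⟨L, hL, hKL⟩ := Sylow.exists_subgroup_card_pow_prime_le (G := H) 2 (n := n) (m := m - 1)
    (hm ▸ pow_dvd_pow 2 (Nat.sub_le m 1)) (K.subgroupOf H) hcard (by omega)
  have hidx : L.index = 2 := by
    have h1 := L.card_mul_index
    rw [hL, hm] at h1
    have h2 : 2 ^ m = 2 ^ (m - 1) * 2 := by rw [← pow_succ]; congr 1; omega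
    rw [h2] at h1
    exact Nat.eq_of_mul_eq_mul_left (by positivity) h1
  have hmem : ∀ g : P, ((g : P ⧸ H).out)⁻¹ * g ∈ H := fun g =>
    QuotientGroup.leftRel_apply.1 (Quotient.exact (QuotientGroup.out_eq' (g : P ⧸ H)))
  have key : ∀ g, ∀ k : H, (⟨_, hmem (g * k)⟩ : H) ∈ L ↔ ((⟨_, hmem g⟩ : H) ∈ L ↔ k ∈ L) := by
    intro g k
    rw [← Subgroup.mul_mem_iff_of_index_two hidx]
    have h1 : ((g * k : P) : P ⧸ H) = (g : P ⧸ H) := QuotientGroup.mk_mul_of_mem g k.2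
    have h2 : (⟨_, hmem (g * k)⟩ : H) = ⟨_, hmem g⟩ * k := by
      ext
      simp [h1, mul_assoc]
    rw [h2]
  have hLH : L.map H.subtype ≤ H := Subgroup.map_subtype_le L
  refine ⟨L.map H.subtype, fun g => decide ((⟨_, hmem g⟩ : H) ∈ L), fun k hk => ?_,
    lt_of_le_of_ne hLH fun e => ?_, fun g k hk => ?_, fun g k hk hk' => ?_⟩
  · exact ⟨⟨k, h.le hk⟩, hKL hk, rfl⟩
  · have : L = ⊤ := by
      rw [eq_top_iff]
      rintro ⟨y, hy⟩ -
      rw [← e] at hy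
      obtain ⟨z, hz, rfl⟩ := hy
      exact hz
    rw [this, Subgroup.index_top] at hidx
    omega
  · obtain ⟨k, hk, rfl⟩ := hk
    refine decide_eq_decide.2 ?_
    rw [Subgroup.coe_subtype, key g k]
    simp only [show k ∈ L from hk, iff_true]
  · have hk2 : (⟨k, hk⟩ : H) ∉ L := fun h' => hk' ⟨_, h', rfl⟩
    beta_reduce
    rw [← decide_not]
    refine decide_eq_decide.2 ((key g ⟨k, hk⟩).trans ?_)
    simp only [hk2, iff_false]

/-- Since `⟨a⟩` is proper in `⟨a, b⟩`, some sign is kept by `a` and changed by `b`; the product with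
the symmetric sign is changed by both. -/
theorem exists_sign_pair [Finite P] (hP : IsPGroup 2 P) {a b : P} (hab : a ∉ Subgroup.zpowers b)
    (hba : b ∉ Subgroup.zpowers a) :
    ∃ s : P → Bool, (∀ g, s (g * a) = !s g) ∧ ∀ g, s (g * b) = !s g := by
  have key : ∀ a b : P, b ∉ Subgroup.zpowers a →
      ∃ s : P → Bool, (∀ g, s (g * a) = s g) ∧ ∀ g, s (g * b) = !s g := by
    intro a b hba
    have ha : a ∈ Subgroup.closure {a, b} := Subgroup.subset_closure (by simp)
    have hb : b ∈ Subgroup.closure {a, b} := Subgroup.subset_closure (by simp)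
    have hlt : Subgroup.zpowers a < Subgroup.closure {a, b} :=
      lt_of_le_of_ne (Subgroup.zpowers_le.2 ha) fun e => hba (e ▸ hb)
    obtain ⟨L, s, hL, hLH, h1, h2⟩ := exists_sign hP hlt
    have haL : a ∈ L := hL (Subgroup.mem_zpowers a)
    refine ⟨s, fun g => h1 g a haL, fun g => h2 g b hb fun hbL => hLH.not_ge ?_⟩
    rw [Subgroup.closure_le]
    rintro y (rfl | rfl)
    exacts [haL, hbL]
  obtain ⟨s, hs, hs'⟩ := key a b hba
  obtain ⟨t, ht, ht'⟩ := key b a hab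
  exact ⟨fun g => xor (s g) (t g), fun g => by simp [hs, ht'], fun g => by simp [hs', ht]⟩

theorem mem_zpowers_of_involution {a b : P} (ha : a * a = 1) (h : b ∈ Subgroup.zpowers a) :
    b = 1 ∨ b = a := by
  obtain ⟨k, rfl⟩ := h
  have h2 : a ^ (2 : ℤ) = 1 := by rw [zpow_two, ha]
  rcases Int.even_or_odd k with ⟨m, rfl⟩ | ⟨m, rfl⟩
  · left
    beta_reduce
    rw [← two_mul, zpow_mul, h2, one_zpow]
  · right
    beta_reduce
    rw [zpow_add_one, zpow_mul, h2, one_zpow, one_mul]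

/-- Two involutions of a finite `2`-group are flipped by a common sign function. -/
theorem exists_sign_involutions [Finite P] (hP : IsPGroup 2 P) {a b : P} (ha : a * a = 1)
    (hb : b * b = 1) (ha1 : a ≠ 1) (hb1 : b ≠ 1) :
    ∃ s : P → Bool, (∀ g, s (g * a) = !s g) ∧ ∀ g, s (g * b) = !s g := by
  by_cases hab : a = b
  · subst hab
    obtain ⟨L, s, -, hL, -, h⟩ := exists_sign hP (K := ⊥) (H := Subgroup.zpowers a)
      (bot_lt_iff_ne_bot.2 (by simpa using ha1))
    have : a ∉ L := fun h' => hL.not_ge (Subgroup.zpowers_le.2 h')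
    have h2 := fun g => h g a (Subgroup.mem_zpowers a) this
    exact ⟨s, h2, h2⟩
  · refine exists_sign_pair hP (fun h => ?_) fun h => ?_
    · exact (mem_zpowers_of_involution hb h).elim ha1 hab
    · exact (mem_zpowers_of_involution ha h).elim hb1 (Ne.symm hab)

/-- The group generated by two involutions is dihedral: every element is a rotation, or becomes one
after multiplication by `a`. -/
theorem mem_closure_involutions {a b h : P} (ha : a * a = 1) (hb : b * b = 1)
    (hh : h ∈ Subgroup.closure {a, b}) :
    h ∈ Subgroup.zpowers (a * b) ∨ h * a ∈ Subgroup.zpowers (a * b) := by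
  have ha' : a⁻¹ = a := inv_eq_of_mul_eq_one_left ha
  have hb' : b⁻¹ = b := inv_eq_of_mul_eq_one_left hb
  have hz : a * b ∈ Subgroup.zpowers (a * b) := Subgroup.mem_zpowers _
  have hz' : b * a ∈ Subgroup.zpowers (a * b) := by
    have : b * a = (a * b)⁻¹ := by rw [mul_inv_rev, ha', hb']
    exact this ▸ inv_mem hz
  have step : ∀ g, (g ∈ Subgroup.zpowers (a * b) ∨ g * a ∈ Subgroup.zpowers (a * b)) →
      ∀ y, y = a ∨ y = b →
        (g * y ∈ Subgroup.zpowers (a * b) ∨ g * y * a ∈ Subgroup.zpowers (a * b)) := by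
    rintro g (hg | hg) y (rfl | rfl)
    · right; rwa [mul_assoc, ha, mul_one]
    · right; rw [mul_assoc]; exact mul_mem hg hz'
    · left; exact hg
    · left
      have : g * y = g * a * (a * y) := by
        rw [mul_assoc, ← mul_assoc a a, ha, one_mul]
      rw [this]
      exact mul_mem hg hz
  induction hh using Subgroup.closure_induction_right with
  | one => exact Or.inl (one_mem _)
  | mul_right g hg y hy ih => exact step g ih y (by simpa using hy)
  | mul_inv_cancel g hg y hy ih =>
    refine step g ih _ ?_
    rcases hy with rfl | rfl
    · exact Or.inl ha'
    · exact Or.inr hb'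

/-- Conjugation by `a` inverts the powers of `a * b`, and `c` is its own inverse. -/
theorem commute_of_mem_zpowers_mul {a b c : P} (ha : a * a = 1) (hb : b * b = 1)
    (hc : c * c = 1) (h : c ∈ Subgroup.zpowers (a * b)) : Commute c a ∧ Commute c b := by
  have hca : Commute c a := by
    obtain ⟨k, rfl⟩ := h
    have h1 : a * (a * b) ^ k * a⁻¹ = ((a * b) ^ k)⁻¹ := by
      rw [← conj_zpow, ← inv_zpow]
      congr 1
      rw [mul_inv_rev, inv_eq_of_mul_eq_one_left ha, inv_eq_of_mul_eq_one_left hb,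
        ← mul_assoc a a, ha, one_mul]
    rw [inv_eq_of_mul_eq_one_left hc, mul_inv_eq_iff_eq_mul] at h1
    exact h1.symm
  have hcab : Commute c (a * b) := by
    obtain ⟨k, rfl⟩ := h
    exact (Commute.refl _).zpow_left k
  refine ⟨hca, ?_⟩
  have : b = a * (a * b) := by rw [← mul_assoc, ha, one_mul]
  rw [this]
  exact hca.mul_right hcab

theorem sign_mul_of_mem_zpowers_mul {a b w : P} {s : P → Bool} (ha : ∀ g, s (g * a) = !s g)
    (hb : ∀ g, s (g * b) = !s g) (hw : w ∈ Subgroup.zpowers (a * b)) (g : P) :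
    s (g * w) = s g := by
  rw [Subgroup.zpowers_eq_closure] at hw
  induction hw using Subgroup.closure_induction generalizing g with
  | mem x hx => rw [Set.mem_singleton_iff.1 hx, ← mul_assoc, hb, ha, Bool.not_not]
  | one => rw [mul_one]
  | mul x y _ _ h1 h2 => rw [← mul_assoc, h2, h1]
  | inv x _ h1 => rw [← h1 (g * x⁻¹), inv_mul_cancel_right]

/-- Either a sign function flips three involutions of a finite `2`-group, or one of them is a
power of the product of the other two. -/
theorem exists_sign_three [Finite P] (hP : IsPGroup 2 P) {a b c : P} (ha : a * a = 1)
    (hb : b * b = 1) (hc : c * c = 1) (ha1 : a ≠ 1) (hb1 : b ≠ 1) (hc1 : c ≠ 1) :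
    (∃ s : P → Bool, (∀ g, s (g * a) = !s g) ∧ (∀ g, s (g * b) = !s g) ∧
      ∀ g, s (g * c) = !s g) ∨
    c ∈ Subgroup.zpowers (a * b) ∨ b ∈ Subgroup.zpowers (a * c) ∨
      a ∈ Subgroup.zpowers (b * c) := by
  -- A reflection `c` of the dihedral group is a rotation times `a`, so a sign changed by `a` and
  -- `b` is changed by `c`.
  have key : ∀ a b c : P, a * a = 1 → b * b = 1 → a ≠ 1 → b ≠ 1 →
      c ∈ Subgroup.closure {a, b} → c ∉ Subgroup.zpowers (a * b) →
      ∃ s : P → Bool, (∀ g, s (g * a) = !s g) ∧ (∀ g, s (g * b) = !s g) ∧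
      ∀ g, s (g * c) = !s g := by
    intro a b c ha hb ha1 hb1 hc hc'
    obtain ⟨s, hsa, hsb⟩ := exists_sign_involutions hP ha hb ha1 hb1
    have h := (mem_closure_involutions ha hb hc).resolve_left hc'
    refine ⟨s, hsa, hsb, fun g => ?_⟩
    have h2 := sign_mul_of_mem_zpowers_mul hsa hsb h g
    rw [← mul_assoc, hsa] at h2
    rw [← h2, Bool.not_not]
  have one : ∀ a b c : P, c ∉ Subgroup.closure {a, b} →
      ∃ s : P → Bool, (∀ g, s (g * a) = s g) ∧ (∀ g, s (g * b) = s g) ∧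
      ∀ g, s (g * c) = !s g := by
    intro a b c hc
    have hle : Subgroup.closure {a, b} ≤ Subgroup.closure {a, b, c} :=
      Subgroup.closure_mono fun y hy => by
        rcases hy with rfl | rfl <;> simp
    have hcm : c ∈ Subgroup.closure {a, b, c} := Subgroup.subset_closure (by simp)
    obtain ⟨L, s, hL, hLH, h1, h2⟩ := exists_sign hP (lt_of_le_of_ne hle fun e => hc (e ▸ hcm))
    have haL : a ∈ L := hL (Subgroup.subset_closure (by simp))
    have hbL : b ∈ L := hL (Subgroup.subset_closure (by simp))
    refine ⟨s, fun g => h1 g a haL, fun g => h1 g b hbL, fun g => h2 g c hcm fun hcL =>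
      hLH.not_ge ?_⟩
    rw [Subgroup.closure_le]
    rintro y (rfl | rfl | rfl)
    exacts [haL, hbL, hcL]
  by_cases h1 : c ∈ Subgroup.closure {a, b}
  · by_cases h : c ∈ Subgroup.zpowers (a * b)
    · exact Or.inr (Or.inl h)
    · exact Or.inl (key a b c ha hb ha1 hb1 h1 h)
  by_cases h2 : b ∈ Subgroup.closure {a, c}
  · by_cases h : b ∈ Subgroup.zpowers (a * c)
    · exact Or.inr (Or.inr (Or.inl h))
    · obtain ⟨s, h1, h2, h3⟩ := key a c b ha hc ha1 hc1 h2 h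
      exact Or.inl ⟨s, h1, h3, h2⟩
  by_cases h3 : a ∈ Subgroup.closure {b, c}
  · by_cases h : a ∈ Subgroup.zpowers (b * c)
    · exact Or.inr (Or.inr (Or.inr h))
    · obtain ⟨s, h1, h2, h3⟩ := key b c a hb hc hb1 hc1 h3 h
      exact Or.inl ⟨s, h3, h1, h2⟩
  -- When no involution lies in the group of the other two, each has a sign changed by it alone; the
  -- product of the three is changed by all.
  obtain ⟨s, s1, s2, s3⟩ := one a b c h1
  obtain ⟨t, t1, t2, t3⟩ := one a c b h2
  obtain ⟨u, u1, u2, u3⟩ := one b c a h3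
  exact Or.inl ⟨fun g => xor (xor (s g) (t g)) (u g), fun g => by simp [s1, t1, u3],
    fun g => by simp [s2, t3, u1], fun g => by simp [s3, t2, u2]⟩

end Sign

/-! ### Signings of four-regular graphs -/

/-- The two darts of each edge get values that differ by `c`. -/
def IsSigning {V T : Type*} (m : V → T → V) (σ : T → T) (c β : V → T → ZMod 2) : Prop :=
  ∀ v i, β (m v i) (σ i) = β v i + c v i

/-- The two darts of an edge are distinct because there are no loops; in a fixed numbering the
earlier one gets `0` and the later one gets `c`. -/
theorem exists_isSigning {V T : Type*} [Fintype V] [Fintype T] {m : V → T → V} {σ : T → T}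
    {c : V → T → ZMod 2} (hm : ∀ v i, m (m v i) (σ i) = v)
    (hσ : ∀ i, σ (σ i) = i) (hne : ∀ v i, m v i ≠ v) (hc : ∀ v i, c (m v i) (σ i) = c v i) :
    ∃ β, IsSigning m σ c β := by
  let e : V × T ≃ Fin (Fintype.card (V × T)) := Fintype.equivFin _
  refine ⟨fun v i => if e (v, i) < e (m v i, σ i) then 0 else c v i, fun v i => ?_⟩
  beta_reduce
  rw [hm, hσ, hc]
  have hne' : e (v, i) ≠ e (m v i, σ i) := fun h =>
    hne v i (congrArg Prod.fst (e.injective h)).symm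
  rcases lt_or_gt_of_ne hne' with h | h
  · rw [if_neg h.asymm, if_pos h, zero_add]
  · rw [if_pos h, if_neg h.asymm, CharTwo.add_self_eq_zero]

section Signing

variable {V T : Type*} [DecidableEq V] [DecidableEq T]

/-- Add `1` on both darts of an edge. -/
def flipEdge (m : V → T → V) (σ : T → T) (v : V) (i : T) (β : V → T → ZMod 2) : V → T → ZMod 2 :=
  fun w k => β w k + (if w = v ∧ k = i then 1 else 0) +
    if w = m v i ∧ k = σ i then 1 else 0

variable {m : V → T → V} {σ : T → T} {c β : V → T → ZMod 2}

theorem IsSigning.flipEdge (hβ : IsSigning m σ c β) (hm : ∀ v i, m (m v i) (σ i) = v)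
    (hσ : ∀ i, σ (σ i) = i) (v : V) (i : T) :
    IsSigning m σ c (flipEdge m σ v i β) := by
  intro w k
  have h1 : (m w k = v ∧ σ k = i) ↔ (w = m v i ∧ k = σ i) := by
    constructor
    · rintro ⟨rfl, rfl⟩; exact ⟨(hm _ _).symm, (hσ _).symm⟩
    · rintro ⟨rfl, rfl⟩; exact ⟨hm _ _, hσ _⟩
  have h2 : (m w k = m v i ∧ σ k = σ i) ↔ (w = v ∧ k = i) := by
    constructor
    · rintro ⟨h, h'⟩
      have h3 : k = i := by rw [← hσ k, h', hσ]
      exact ⟨by rw [← hm w k, h, h', hm], h3⟩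
    · rintro ⟨rfl, rfl⟩; exact ⟨rfl, rfl⟩
  simp only [_root_.flipEdge, h1, h2, hβ w k]
  ring

theorem sum_flipEdge [Fintype T] (v : V) (i : T) (β : V → T → ZMod 2) (w : V) :
    ∑ k, flipEdge m σ v i β w k =
      ∑ k, β w k + (if w = v then 1 else 0) + if w = m v i then 1 else 0 := by
  simp only [flipEdge, Finset.sum_add_distrib, ite_and]
  congr 1
  · congr 1
    split_ifs <;> simp
  · split_ifs <;> simp

theorem flipEdge_apply_of_ne {v w : V} {i : T} (h1 : w ≠ v) (h2 : w ≠ m v i) :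
    flipEdge m σ v i β w = β w := by
  ext k
  simp [flipEdge, h1, h2]

theorem flipEdge_self {v : V} {i : T} (h : m v i ≠ v) (k : T) :
    flipEdge m σ v i β v k = β v k + if k = i then 1 else 0 := by
  simp [flipEdge, h.symm]

/-- Two vertices joined by a path avoiding `v₀` can have their parities changed without touching
the darts at `v₀`. -/
theorem IsSigning.exists_flip_path [Fintype T] (hm : ∀ v i, m (m v i) (σ i) = v)
    (hσ : ∀ i, σ (σ i) = i) (v₀ : V) {u w : V}
    (huw : Relation.ReflTransGen (fun y z => y ≠ v₀ ∧ z ≠ v₀ ∧ ∃ i, m y i = z) u w) :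
    ∀ β, IsSigning m σ c β → ∃ β', IsSigning m σ c β' ∧ β' v₀ = β v₀ ∧
      ∀ v, ∑ k, β' v k = ∑ k, β v k + (if v = u then 1 else 0) + if v = w then 1 else 0 := by
  induction huw with
  | refl =>
    intro β hβ
    refine ⟨β, hβ, rfl, fun v => ?_⟩
    rw [add_assoc, CharTwo.add_self_eq_zero, add_zero]
  | tail _ h ih =>
    rename_i y z _
    obtain ⟨hy, hz, i, rfl⟩ := h
    intro β hβ
    obtain ⟨β₁, h1, h2, h3⟩ := ih β hβ
    -- The two changes at the intermediate vertex `y` cancel, so only the ends of the extended path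
    -- change parity.
    refine ⟨_, h1.flipEdge hm hσ y i, ?_, fun v => ?_⟩
    · rw [flipEdge_apply_of_ne hy.symm hz.symm, h2]
    · rw [sum_flipEdge, h3]
      have := CharTwo.add_self_eq_zero (if v = y then (1 : ZMod 2) else 0)
      linear_combination this

/-- A connected four-regular loopless multigraph, given by its darts, has a signing without
balanced vertices. -/
theorem exists_isSigning_card_ne_two [Fintype V] [Nonempty V] [Fintype T] (hT : Fintype.card T = 4)
    (hm : ∀ v i, m (m v i) (σ i) = v) (hσ : ∀ i, σ (σ i) = i) (hne : ∀ v i, m v i ≠ v)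
    (hc : ∀ v i, c (m v i) (σ i) = c v i)
    (hconn : ∀ u w, Relation.ReflTransGen (fun y z => ∃ i, m y i = z) u w) :
    ∃ β, IsSigning m σ c β ∧ ∀ v, (Finset.univ.filter fun i => β v i = 1).card ≠ 2 := by
  have : Nonempty T := Fintype.card_pos_iff.1 (by omega)
  let Γ : SimpleGraph V :=
    { Adj := fun y z => ∃ i, m y i = z
      symm := ⟨fun y z ⟨i, h⟩ => ⟨σ i, by rw [← h, hm]⟩⟩
      loopless := ⟨fun y ⟨i, h⟩ => hne y i h⟩ }
  have hΓ : Γ.Connected := by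
    refine ⟨fun u w => ?_⟩
    rw [SimpleGraph.reachable_iff_reflTransGen]
    exact hconn u w
  have : Nontrivial V := by
    obtain ⟨v⟩ := ‹Nonempty V›
    obtain ⟨i⟩ := ‹Nonempty T›
    exact ⟨⟨_, _, hne v i⟩⟩
  -- The vertex `v₀` is not a cut vertex. Every other vertex will have an odd number of ones, hence
  -- not two; `v₀` is treated separately.
  obtain ⟨v₀, hv₀⟩ := hΓ.exists_connected_induce_compl_singleton_of_finite_nontrivial
  have path : ∀ u w, u ≠ v₀ → w ≠ v₀ →
      Relation.ReflTransGen (fun y z => y ≠ v₀ ∧ z ≠ v₀ ∧ ∃ i, m y i = z) u w := by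
    intro u w hu hw
    have h := (SimpleGraph.reachable_iff_reflTransGen _ _).1
      (hv₀.preconnected ⟨u, by simpa using hu⟩ ⟨w, by simpa using hw⟩)
    exact h.lift Subtype.val fun y z hyz => ⟨y.2, z.2, hyz⟩
  -- A path from `u` to a neighbour of `v₀`, continued to `v₀`, changes among the vertices other
  -- than `v₀` only the parity of `u`.
  have change : ∀ u, u ≠ v₀ → ∀ β, IsSigning m σ c β → ∃ β', IsSigning m σ c β' ∧
      ∀ v, v ≠ v₀ → ∑ k, β' v k = ∑ k, β v k + if v = u then 1 else 0 := by
    intro u hu β hβ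
    obtain ⟨i⟩ := ‹Nonempty T›
    obtain ⟨β₁, h1, -, h3⟩ := hβ.exists_flip_path hm hσ v₀ (path u (m v₀ i) hu (hne v₀ i))
    refine ⟨_, h1.flipEdge hm hσ v₀ i, fun v hv => ?_⟩
    rw [sum_flipEdge, h3, if_neg hv]
    have := CharTwo.add_self_eq_zero (if v = m v₀ i then (1 : ZMod 2) else 0)
    linear_combination this
  have all : ∀ S : Finset V, v₀ ∉ S → ∀ β, IsSigning m σ c β → ∃ β', IsSigning m σ c β' ∧
      ∀ v, v ≠ v₀ → ∑ k, β' v k = ∑ k, β v k + if v ∈ S then 1 else 0 := by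
    intro S
    induction S using Finset.induction_on with
    | empty => exact fun _ β hβ => ⟨β, hβ, by simp⟩
    | insert u S hu ih =>
      intro hS β hβ
      simp only [Finset.mem_insert, not_or] at hS
      obtain ⟨β₁, h1, h2⟩ := ih hS.2 β hβ
      obtain ⟨β₂, h3, h4⟩ := change u (Ne.symm hS.1) β₁ h1
      refine ⟨β₂, h3, fun v hv => ?_⟩
      rw [h4 v hv, h2 v hv]
      by_cases h : v = u
      · subst h; simp [hu]
      · simp [h]
  obtain ⟨β₀, hβ₀⟩ := exists_isSigning hm hσ hne hc
  obtain ⟨β, hβ, hodd⟩ : ∃ β, IsSigning m σ c β ∧ ∀ v, v ≠ v₀ → ∑ k, β v k = 1 := by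
    obtain ⟨β, h1, h2⟩ := all (Finset.univ.filter fun v => v ≠ v₀ ∧ ∑ k, β₀ v k = 0)
      (by simp) β₀ hβ₀
    refine ⟨β, h1, fun v hv => ?_⟩
    rw [h2 v hv]
    have : ∀ z : ZMod 2, z = 0 ∨ z = 1 := by decide
    rcases this (∑ k, β₀ v k) with h | h
    · simp [h, hv]
    · simp [h]
  have hcard : ∀ (β : V → T → ZMod 2) v, ∑ k, β v k =
      ((Finset.univ.filter fun i => β v i = 1).card : ZMod 2) := by
    intro β v
    rw [Finset.card_filter]
    push_cast
    refine Finset.sum_congr rfl fun k _ => ?_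
    have : ∀ z : ZMod 2, z = if z = 1 then 1 else 0 := by decide
    exact this _
  have good : ∀ (β : V → T → ZMod 2) v, ∑ k, β v k = 1 →
      (Finset.univ.filter fun i => β v i = 1).card ≠ 2 := by
    intro β v h h2
    rw [hcard, h2] at h
    exact absurd h (by decide)
  by_cases h0 : (Finset.univ.filter fun i => β v₀ i = 1).card = 2
  swap
  · refine ⟨β, hβ, fun v => ?_⟩
    by_cases hv : v = v₀
    · rwa [hv]
    · exact good β v (hodd v hv)
  have hcompl : (Finset.univ.filter fun i => ¬ β v₀ i = 1).card = 2 := by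
    have := Finset.card_filter_add_card_filter_not (s := Finset.univ) fun i => β v₀ i = 1
    rw [h0, Finset.card_univ, hT] at this
    omega
  obtain ⟨i, j, hij, heq⟩ := Finset.card_eq_two.1 hcompl
  have hmem : ∀ k, ¬ β v₀ k = 1 ↔ k = i ∨ k = j := fun k => by
    have := Finset.ext_iff.1 heq k
    simpa using this
  -- If `v₀` is balanced, the closed walk through its two zero darts `i` and `j` is flipped. No
  -- parity changes, and all four darts at `v₀` become one.
  obtain ⟨β₁, h1, h2, h3⟩ :=
    hβ.exists_flip_path hm hσ v₀ (path (m v₀ i) (m v₀ j) (hne v₀ i) (hne v₀ j))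
  refine ⟨_, (h1.flipEdge hm hσ v₀ i).flipEdge hm hσ v₀ j, fun v => ?_⟩
  by_cases hv : v = v₀
  · subst hv
    have hall : ∀ k, flipEdge m σ v j (flipEdge m σ v i β₁) v k = 1 := by
      intro k
      rw [flipEdge_self (hne v j), flipEdge_self (hne v i), h2]
      have h01 : ∀ z : ZMod 2, ¬ z = 1 → z = 0 := by decide
      by_cases hk : β v k = 1
      · have := mt (hmem k).2 (not_not.2 hk)
        rw [not_or] at this
        simp [hk, this.1, this.2]
      · rcases (hmem k).1 hk with rfl | rfl
        · simp [h01 _ hk, hij]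
        · simp [h01 _ hk, hij.symm]
    rw [Finset.filter_true_of_mem fun k _ => hall k, Finset.card_univ, hT]
    decide
  · refine good _ v ?_
    rw [sum_flipEdge, sum_flipEdge, h3, hodd v hv, if_neg hv]
    have e1 := CharTwo.add_self_eq_zero (if v = m v₀ i then (1 : ZMod 2) else 0)
    have e2 := CharTwo.add_self_eq_zero (if v = m v₀ j then (1 : ZMod 2) else 0)
    linear_combination e1 + e2

end Signing

/-! ### Central involutions -/

/-- The sign `1` or `-1` in `ZMod 3` attached to a parity. -/
def paritySign (z : ZMod 2) : ZMod 3 := if z = 0 then 1 else -1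

theorem paritySign_add_one : ∀ z, paritySign (z + 1) = -paritySign z := by decide

theorem paritySign_ne_zero : ∀ z, paritySign z ≠ 0 := by decide

/-- With `n` negative signs among four the sum is `4 - 2 * n` up to sign, and for `n ≤ 4` this is
divisible by 3 only if `n = 2`. -/
theorem sum_paritySign_ne_zero {T : Type*} [Fintype T] (hT : Fintype.card T = 4)
    (β : T → ZMod 2) (hβ : (Finset.univ.filter fun i => β i = 1).card ≠ 2) (z : ZMod 2) :
    ∑ i, paritySign (z + β i) ≠ 0 := by
  have h0 : ∀ z w : ZMod 2, paritySign (z + w) = paritySign z * (if w = 1 then -1 else 1) := by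
    decide
  simp only [h0, ← Finset.mul_sum]
  refine mul_ne_zero (paritySign_ne_zero z) ?_
  have hle := Finset.card_filter_add_card_filter_not (s := Finset.univ) fun i => β i = 1
  rw [Finset.card_univ, hT] at hle
  rw [Finset.sum_ite, Finset.sum_const, Finset.sum_const, nsmul_eq_mul, nsmul_eq_mul]
  generalize (Finset.univ.filter fun i => β i = 1).card = n at *
  generalize (Finset.univ.filter fun i => ¬ β i = 1).card = k at *
  obtain rfl : k = 4 - n := by omega
  have : n ≤ 4 := by omega
  interval_cases n
  · decide
  · decide
  · exact absurd rfl hβ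
  · decide
  · decide

namespace HasFlow

variable {G ι : Type*} [Group G] {x : ι → G} {σ : ι → ι}

/-- The four labels of `t` make the quotient by the central involution a connected loopless
four-regular multigraph. A signing of it without balanced vertices lifts to signs on these labels
that change under `x i₀`. The edge of `i₀` absorbs their sum, which is then nonzero and
antisymmetric. -/
theorem of_central_of_closure [Finite G] [DecidableEq ι] {i₀ : ι} {t : Finset ι}
    (ht : t.card = 4) (hi₀ : i₀ ∉ t) (hσ0 : σ i₀ = i₀) (hσt : ∀ i ∈ t, σ i ∈ t)
    (hσσ : ∀ i ∈ t, σ (σ i) = i) (hx : ∀ i ∈ t, x (σ i) = (x i)⁻¹) (ha : x i₀ * x i₀ = 1)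
    (ha1 : x i₀ ≠ 1) (hcomm : ∀ g, Commute (x i₀) g)
    (hne : ∀ i ∈ t, x i ≠ 1 ∧ x i ≠ x i₀)
    (hgen : Subgroup.closure (insert (x i₀) (x '' t)) = ⊤) : HasFlow x σ (insert i₀ t) := by
  classical
  set a := x i₀ with hadef
  set A := Subgroup.zpowers a with hA
  have hnormal : A.Normal := ⟨fun z hz g => by
    obtain ⟨k, rfl⟩ := hz
    have : g * a ^ k * g⁻¹ = a ^ k := by
      rw [mul_inv_eq_iff_eq_mul]
      exact (((hcomm g).zpow_left k).eq).symm
    beta_reduce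
    rw [this]
    exact Subgroup.zpow_mem_zpowers a k⟩
  have := Fintype.ofFinite (G ⧸ A)
  have hout : ∀ g : G, g = (g : G ⧸ A).out ∨ g = (g : G ⧸ A).out * a := by
    intro g
    have h : ((g : G ⧸ A).out)⁻¹ * g ∈ A :=
      QuotientGroup.leftRel_apply.1 (Quotient.exact (QuotientGroup.out_eq' (g : G ⧸ A)))
    rcases mem_zpowers_of_involution ha h with h | h
    · left; exact (inv_mul_eq_one.1 h).symm
    · right; exact inv_mul_eq_iff_eq_mul.1 h
  have hmka : ∀ g : G, ((g * a : G) : G ⧸ A) = g := fun g =>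
    QuotientGroup.mk_mul_of_mem g (Subgroup.mem_zpowers a)
  -- The parity `p` tells the two elements of each coset of `⟨a⟩` apart. Its increment along an edge
  -- depends only on the coset, since `a` is central.
  obtain ⟨p, hp⟩ : ∃ p : G → ZMod 2, ∀ g, p (g * a) = p g + 1 := by
    refine ⟨fun g => if g = (g : G ⧸ A).out then 0 else 1, fun g => ?_⟩
    beta_reduce
    rw [hmka]
    rcases hout g with h | h
    · have h' : g * a ≠ (g : G ⧸ A).out := by
        rw [← h]; simpa using ha1
      rw [if_neg h', if_pos h, zero_add]
    · have h' : g * a = (g : G ⧸ A).out := by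
        conv_lhs => rw [h]
        rw [mul_assoc, ha, mul_one]
      have h'' : g ≠ (g : G ⧸ A).out := by
        rw [← h']; simpa using ha1
      rw [if_pos h', if_neg h'']
      decide
  have hp2 : ∀ g h : G, p (g * h) + p g = p ((g : G ⧸ A).out * h) + p (g : G ⧸ A).out := by
    intro g h
    rcases hout g with h1 | h1
    · rw [← h1]
    · conv_lhs => rw [h1]
      rw [mul_assoc, (hcomm h).eq, ← mul_assoc, hp, hp]
      have : (1 : ZMod 2) + 1 = 0 := by decide
      linear_combination this
  let T := {i // i ∈ t}
  have hT : Fintype.card T = 4 := by rw [Fintype.card_coe, ht]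
  let τ : T → T := fun i => ⟨σ i, hσt i i.2⟩
  let m : G ⧸ A → T → G ⧸ A := fun v i => v * ((x i : G) : G ⧸ A)
  -- The summand `1` makes the two darts of a lifted edge opposite; the other terms compensate the
  -- change of `p` along it.
  let c : G ⧸ A → T → ZMod 2 := fun v i => 1 + (p (v.out * x i) + p v.out)
  have hm : ∀ v i, m (m v i) (τ i) = v := fun v i => by
    simp only [m, τ, hx i i.2, QuotientGroup.mk_inv, mul_inv_cancel_right]
  have hτ : ∀ i, τ (τ i) = i := fun i => Subtype.ext (hσσ i i.2)
  have hmne : ∀ v i, m v i ≠ v := fun v i h => by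
    have h1 : ((x i : G) : G ⧸ A) = 1 := mul_eq_left.1 h
    rw [QuotientGroup.eq_one_iff] at h1
    exact (mem_zpowers_of_involution ha h1).elim (hne i i.2).1 (hne i i.2).2
  have hc : ∀ v i, c (m v i) (τ i) = c v i := fun v i => by
    have h1 : ((v.out * x i : G) : G ⧸ A) = m v i := by
      simp [m]
    have h2 := hp2 (v.out * x i) (x (σ i))
    rw [h1, hx i i.2, mul_inv_cancel_right] at h2
    simp only [c, τ, hx i i.2]
    rw [← h2]
    ring
  have hconn : ∀ u w, Relation.ReflTransGen (fun y z => ∃ i, m y i = z) u w := by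
    have : Std.Symm fun y z : G ⧸ A => ∃ i, m y i = z :=
      ⟨fun y z ⟨i, h⟩ => ⟨τ i, by rw [← h, hm]⟩⟩
    have key : ∀ g : G, ∀ u : G ⧸ A,
        Relation.ReflTransGen (fun y z => ∃ i, m y i = z) u (u * (g : G ⧸ A)) := by
      intro g
      have hg : g ∈ Subgroup.closure (insert a (x '' t)) := hgen ▸ Subgroup.mem_top g
      induction hg using Subgroup.closure_induction with
      | mem y hy =>
        intro u
        rcases hy with rfl | ⟨i, hi, rfl⟩
        · have : ((a : G) : G ⧸ A) = 1 :=
            (QuotientGroup.eq_one_iff a).2 (Subgroup.mem_zpowers a)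
          rw [this, mul_one]
        · exact Relation.ReflTransGen.single ⟨⟨i, hi⟩, rfl⟩
      | one => intro u; rw [QuotientGroup.mk_one, mul_one]
      | mul y z _ _ h1 h2 =>
        intro u
        rw [QuotientGroup.mk_mul, ← mul_assoc]
        exact (h1 u).trans (h2 _)
      | inv y _ h1 =>
        intro u
        have := h1 (u * ((y⁻¹ : G) : G ⧸ A))
        rw [QuotientGroup.mk_inv, inv_mul_cancel_right] at this
        exact Std.Symm.symm _ _ this
    intro u w
    obtain ⟨g, hg⟩ := QuotientGroup.mk_surjective (u⁻¹ * w)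
    have := key g u
    rwa [hg, mul_inv_cancel_left] at this
  obtain ⟨β, hβ, hβ2⟩ := exists_isSigning_card_ne_two hT hm hτ hmne hc hconn
  let w : G → T → ZMod 3 := fun g k => paritySign (p g + β g k)
  have hw : ∀ g (i : T), w (g * x i) (τ i) = -w g i := fun g i => by
    have h1 : ((g * x i : G) : G ⧸ A) = m g i := rfl
    simp only [w]
    rw [← paritySign_add_one, h1, hβ]
    congr 1
    have := hp2 g (x i)
    simp only [c]
    rw [← this]
    have := CharTwo.add_self_eq_zero (p (g * x i))
    linear_combination this
  have hwa : ∀ g i, w (g * a) i = -w g i := fun g i => by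
    simp only [w]
    rw [hmka, hp, ← paritySign_add_one]
    congr 1
    ring
  refine ⟨fun g i => if h : i ∈ t then w g ⟨i, h⟩ else -∑ k, w g k, fun g i hi => ?_,
    fun g i hi => ?_, fun g => ?_⟩
  · by_cases h : i ∈ t
    · simp only [h, dif_pos]
      exact paritySign_ne_zero _
    · simp only [h, dif_neg, not_false_iff, neg_ne_zero]
      exact sum_paritySign_ne_zero hT _ (hβ2 _) _
  · by_cases h : i ∈ t
    · simp only [h, hσt i h, dif_pos]
      exact hw g ⟨i, h⟩
    · obtain rfl := (Finset.mem_insert.1 hi).resolve_right h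
      simp only [hσ0, h, dif_neg, not_false_iff]
      rw [← hadef]
      simp only [hwa, Finset.sum_neg_distrib]
  · beta_reduce
    rw [Finset.sum_insert hi₀, dif_neg hi₀, ← Finset.sum_coe_sort t]
    simp only [Finset.coe_mem, dif_pos, Subtype.coe_eta]
    exact neg_add_cancel _

/-- A central involution together with four further labels, none of them a power of it, carries a
flow. -/
theorem of_central [Finite G] [DecidableEq ι] {i₀ : ι} {t : Finset ι}
    (ht : t.card = 4) (hi₀ : i₀ ∉ t) (hσ0 : σ i₀ = i₀) (hσt : ∀ i ∈ t, σ i ∈ t)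
    (hσσ : ∀ i ∈ t, σ (σ i) = i) (hx : ∀ i ∈ t, x (σ i) = (x i)⁻¹) (ha : x i₀ * x i₀ = 1)
    (ha1 : x i₀ ≠ 1) (hcomm : ∀ i ∈ t, Commute (x i₀) (x i))
    (hne : ∀ i ∈ t, x i ≠ 1 ∧ x i ≠ x i₀) : HasFlow x σ (insert i₀ t) := by
  classical
  -- In the subgroup generated by these labels the involution is central and the quotient graph is
  -- connected.
  set H := Subgroup.closure (insert (x i₀) (x '' t)) with hH
  have hmem0 : x i₀ ∈ H := Subgroup.subset_closure (Set.mem_insert _ _)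
  have hmem : ∀ i ∈ t, x i ∈ H := fun i hi =>
    Subgroup.subset_closure (Set.mem_insert_of_mem _ ⟨i, hi, rfl⟩)
  let x' : ι → H := fun i => if h : x i ∈ H then ⟨x i, h⟩ else 1
  have hx' : ∀ i, x i ∈ H → (x' i : G) = x i := fun i h => by simp [x', h]
  have e0 := hx' i₀ hmem0
  have e : ∀ i ∈ t, (x' i : G) = x i := fun i hi => hx' i (hmem i hi)
  refine of_subgroup H x' (fun i hi => ?_) (of_central_of_closure ht hi₀ hσ0 hσt hσσ
    (fun i hi => ?_) ?_ ?_ (fun g => ?_) (fun i hi => ?_) ?_)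
  · rcases Finset.mem_insert.1 hi with rfl | hi
    exacts [e0, e i hi]
  · ext
    rw [e _ (hσt i hi), hx i hi, Subgroup.coe_inv, e i hi]
  · ext
    rw [Subgroup.coe_mul, e0, ha, Subgroup.coe_one]
  · intro h
    exact ha1 (by rw [← e0, h, Subgroup.coe_one])
  · have hle : H ≤ Subgroup.centralizer {x i₀} := by
      rw [hH, Subgroup.closure_le]
      rintro y (rfl | ⟨i, hi, rfl⟩)
      · exact Subgroup.mem_centralizer_singleton_iff.2 rfl
      · exact Subgroup.mem_centralizer_singleton_iff.2 (hcomm i hi).eq.symm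
    ext
    rw [Subgroup.coe_mul, Subgroup.coe_mul, e0]
    exact (Subgroup.mem_centralizer_singleton_iff.1 (hle g.2)).symm
  · refine ⟨fun h => (hne i hi).1 ?_, fun h => (hne i hi).2 ?_⟩
    · rw [← e i hi, h, Subgroup.coe_one]
    · rw [← e i hi, h, e0]
  · have : insert (x' i₀) (x' '' t) = H.subtype ⁻¹' (insert (x i₀) (x '' t)) := by
      ext z
      simp only [Set.mem_insert_iff, Set.mem_image, Set.mem_preimage, Subgroup.coe_subtype,
        Finset.mem_coe]
      refine or_congr ?_ (exists_congr fun i => and_congr_right fun hi => ?_)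
      · rw [← e0, Subtype.ext_iff]
      · rw [← e i hi, Subtype.ext_iff]
    rw [this]
    exact Subgroup.closure_closure_coe_preimage

end HasFlow

/-! ### Reduction to a quotient of order a power of two -/

namespace HasFlow

variable {G P ι : Type*} [Group G] [Group P] [DecidableEq ι] {x : ι → G} {σ : ι → ι}
  {s : Finset ι}

theorem of_even_card_fixed [Finite P] (hP : IsPGroup 2 P) (y : ι → P) (F : Finset ι)
    (hfix : ∀ i ∈ F, σ i = i) (hy : ∀ i ∈ F, y i * y i = 1) (hy1 : ∀ i ∈ F, y i ≠ 1)
    (heven : Even F.card) : HasFlow y σ F := by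
  induction F using Finset.strongInduction with
  | H F ih =>
    rcases F.eq_empty_or_nonempty with rfl | hne
    · exact empty
    have h2 : 1 < F.card := by
      have := hne.card_pos
      obtain ⟨k, hk⟩ := heven
      omega
    obtain ⟨i, hi, j, hj, hij⟩ := Finset.one_lt_card.1 h2
    have hsub : ({i, j} : Finset ι) ⊆ F := by
      intro k hk
      rcases Finset.mem_insert.1 hk with rfl | hk
      · exact hi
      · rwa [Finset.mem_singleton.1 hk]
    have hsd : ∀ k ∈ F \ {i, j}, k ∈ F := fun k hk => (Finset.mem_sdiff.1 hk).1
    obtain ⟨r, hri, hrj⟩ := exists_sign_involutions hP (hy i hi) (hy j hj) (hy1 i hi) (hy1 j hj)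
    rw [← Finset.union_sdiff_of_subset hsub]
    refine union (of_pair hij (hfix i hi) (hfix j hj) r hri hrj)
      (ih _ (Finset.sdiff_ssubset hsub ⟨i, by simp⟩) (fun k hk => hfix k (hsd k hk))
        (fun k hk => hy k (hsd k hk)) (fun k hk => hy1 k (hsd k hk)) ?_)
      Finset.disjoint_sdiff (fun k hk => (hfix k (hsub hk)).symm ▸ hk)
      fun k hk => (hfix k (hsd k hk)).symm ▸ hk
    rw [Finset.card_sdiff_of_subset hsub, Finset.card_pair hij]
    obtain ⟨k, hk⟩ := heven
    exact ⟨k - 1, by omega⟩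

/-- A flow on some of the labels extends to all of them, if the number of remaining involutory
labels is even. -/
theorem extend [Finite P] (hP : IsPGroup 2 P) (φ : G →* P) (hσs : ∀ i ∈ s, σ i ∈ s)
    (hσσ : ∀ i ∈ s, σ (σ i) = i) (hx : ∀ i ∈ s, x (σ i) = (x i)⁻¹)
    (hfix : ∀ i ∈ s, σ i = i → φ (x i) ≠ 1) {u : Finset ι} (hus : u ⊆ s)
    (hσu : ∀ i ∈ u, σ i ∈ u) (hu : HasFlow x σ u)
    (heven : Even ((s \ u).filter fun i => σ i = i).card) : HasFlow x σ s := by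
  have hsd : ∀ i ∈ s \ u, σ i ∈ s \ u := fun i hi => by
    rw [Finset.mem_sdiff] at hi ⊢
    exact ⟨hσs i hi.1, fun h => hi.2 (hσσ i hi.1 ▸ hσu _ h)⟩
  have h1 : HasFlow x σ ((s \ u).filter fun i => σ i = i) := by
    refine of_hom φ (of_even_card_fixed hP _ _ (fun i hi => (Finset.mem_filter.1 hi).2)
      (fun i hi => ?_) (fun i hi => ?_) heven)
    · rw [Finset.mem_filter, Finset.mem_sdiff] at hi
      have := hx i hi.1.1
      rw [hi.2, eq_inv_iff_mul_eq_one] at this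
      rw [← map_mul, this, map_one]
    · rw [Finset.mem_filter, Finset.mem_sdiff] at hi
      exact hfix i hi.1.1 hi.2
  have hmem : ∀ i ∈ s \ u, i ∈ s := fun i hi => (Finset.mem_sdiff.1 hi).1
  have hfil : ∀ i ∈ (s \ u).filter (fun i => ¬ σ i = i), i ∈ s \ u ∧ ¬ σ i = i := fun i hi =>
    Finset.mem_filter.1 hi
  have h2 : HasFlow x σ ((s \ u).filter fun i => ¬ σ i = i) := by
    refine of_forall_ne (fun i hi => hσσ i (hmem i (hfil i hi).1)) (fun i hi => ?_)
      fun i hi => (hfil i hi).2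
    obtain ⟨h, h'⟩ := hfil i hi
    exact Finset.mem_filter.2 ⟨hsd i h, fun e => h' (by rwa [hσσ i (hmem i h), eq_comm] at e)⟩
  have h3 := h1.union h2 (Finset.disjoint_filter_filter_not _ _ _)
    (fun i hi => by
      have h := (Finset.mem_filter.1 hi).2
      rwa [h])
    (fun i hi => by
      obtain ⟨h, h'⟩ := hfil i hi
      exact Finset.mem_filter.2
        ⟨hsd i h, fun e => h' (by rwa [hσσ i (hmem i h), eq_comm] at e)⟩)
  rw [Finset.filter_union_filter_not_eq] at h3
  have h4 := hu.union h3 Finset.disjoint_sdiff hσu hsd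
  rwa [Finset.union_sdiff_of_subset hus] at h4

/-- Apart from one exceptional configuration, a flow exists as soon as the labels generate a
noncyclic quotient of order a power of two. -/
theorem or_exceptional [Finite P] (hP : IsPGroup 2 P) (hcyc : ¬ IsCyclic P) (φ : G →* P)
    (hσs : ∀ i ∈ s, σ i ∈ s) (hσσ : ∀ i ∈ s, σ (σ i) = i) (hx : ∀ i ∈ s, x (σ i) = (x i)⁻¹)
    (hfix : ∀ i ∈ s, σ i = i → φ (x i) ≠ 1)
    (hgen : Subgroup.closure ((fun i => φ (x i)) '' s) = ⊤) :
    HasFlow x σ s ∨ ∃ a b c, a ≠ b ∧ a ≠ c ∧ b ≠ c ∧ (s.filter fun i => σ i = i) = {a, b, c} ∧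
      φ (x c) ∈ Subgroup.zpowers (φ (x a) * φ (x b)) ∧ ∀ i ∈ s, σ i ≠ i → φ (x i) = 1 := by
  set F := s.filter fun i => σ i = i with hF
  have memF : ∀ i, i ∈ F ↔ i ∈ s ∧ σ i = i := fun i => Finset.mem_filter
  have hy : ∀ i ∈ s, φ (x (σ i)) = (φ (x i))⁻¹ := fun i hi => by rw [hx i hi, map_inv]
  have hF1 : ∀ i ∈ F, φ (x i) ≠ 1 := fun i hi => hfix i ((memF i).1 hi).1 ((memF i).1 hi).2
  have hF2 : ∀ i ∈ F, φ (x i) * φ (x i) = 1 := fun i hi => by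
    have := hy i ((memF i).1 hi).1
    rwa [((memF i).1 hi).2, eq_inv_iff_mul_eq_one] at this
  by_cases hpar : Even F.card
  · exact Or.inl (extend hP φ hσs hσσ hx hfix (Finset.empty_subset s) (by simp) empty
      (by simpa using hpar))
  by_contra hcon
  rw [not_or] at hcon
  obtain ⟨hno, hexc⟩ := hcon
  -- As `F` is odd, a block with an odd number of involutory labels leaves an even number of them to
  -- be paired off.
  have hext : ∀ u ⊆ s, (∀ i ∈ u, σ i ∈ u) → ¬ Even (u.filter fun i => σ i = i).card →
      ¬ HasFlow (fun i => φ (x i)) σ u := by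
    intro u hu hσu hodd hflow
    refine hno (extend hP φ hσs hσσ hx hfix hu hσu (of_hom φ hflow) ?_)
    have h1 : (s \ u).filter (fun i => σ i = i) = F \ u.filter fun i => σ i = i := by
      ext i
      simp only [hF, Finset.mem_filter, Finset.mem_sdiff]
      tauto
    have h2 : (u.filter fun i => σ i = i) ⊆ F := Finset.filter_subset_filter _ hu
    rw [h1, Finset.card_sdiff_of_subset h2, Nat.even_sub (Finset.card_le_card h2)]
    tauto
  have htri : ∀ i ∈ F, ∀ j ∈ F, ∀ k ∈ F, i ≠ j → i ≠ k → j ≠ k →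
      ¬ ∃ r : P → Bool, (∀ g, r (g * φ (x i)) = !r g) ∧ (∀ g, r (g * φ (x j)) = !r g) ∧
        ∀ g, r (g * φ (x k)) = !r g := by
    rintro i hi j hj k hk hij hik hjk ⟨r, hri, hrj, hrk⟩
    have hcard : ({i, j, k} : Finset ι).card = 3 := Finset.card_eq_three.2
      ⟨i, j, k, hij, hik, hjk, rfl⟩
    have hmem : ∀ l ∈ ({i, j, k} : Finset ι), l ∈ F := by
      intro l hl
      simp only [Finset.mem_insert, Finset.mem_singleton] at hl
      rcases hl with rfl | rfl | rfl <;> assumption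
    refine hext {i, j, k} (fun l hl => ((memF l).1 (hmem l hl)).1)
      (fun l hl => by rwa [((memF l).1 (hmem l hl)).2]) ?_
      (of_card_three r (fun g l hl => ?_) hcard)
    · rw [Finset.filter_true_of_mem fun l hl => ((memF l).1 (hmem l hl)).2, hcard]
      decide
    · simp only [Finset.mem_insert, Finset.mem_singleton] at hl
      rcases hl with rfl | rfl | rfl
      exacts [hri g, hrj g, hrk g]
  have hpair : ∀ i ∈ F, ∀ l ∈ s, σ l ≠ l →
      ¬ ∃ r : P → Bool, (∀ g, r (g * φ (x i)) = !r g) ∧ ∀ g, r (g * φ (x l)) = !r g := by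
    rintro i hi l hl hll ⟨r, hri, hrl⟩
    obtain ⟨his, hii⟩ := (memF i).1 hi
    have hil : i ≠ l := fun h => hll (h ▸ hii)
    have hil' : i ≠ σ l := fun h => hil (by rw [← hσσ l hl, ← h, hii])
    have hcard : ({i, l, σ l} : Finset ι).card = 3 := Finset.card_eq_three.2
      ⟨i, l, σ l, hil, hil', hll.symm, rfl⟩
    refine hext {i, l, σ l} (fun k hk => ?_) (fun k hk => ?_) ?_
      (of_card_three r (fun g k hk => ?_) hcard)
    · simp only [Finset.mem_insert, Finset.mem_singleton] at hk
      rcases hk with rfl | rfl | rfl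
      exacts [his, hl, hσs _ hl]
    · simp only [Finset.mem_insert, Finset.mem_singleton] at hk ⊢
      rcases hk with rfl | rfl | rfl
      · simp [hii]
      · simp
      · simp [hσσ l hl]
    · have : ({i, l, σ l} : Finset ι).filter (fun i => σ i = i) = {i} := by
        ext k
        simp only [Finset.mem_filter, Finset.mem_insert, Finset.mem_singleton]
        constructor
        · rintro ⟨rfl | rfl | rfl, h⟩
          · rfl
          · exact absurd h hll
          · rw [hσσ l hl] at h
            exact absurd h.symm hll
        · rintro rfl
          exact ⟨Or.inl rfl, hii⟩
      rw [this, Finset.card_singleton]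
      decide
    · simp only [Finset.mem_insert, Finset.mem_singleton] at hk
      rcases hk with rfl | rfl | rfl
      · exact hri g
      · exact hrl g
      · rw [hy l hl]
        have := hrl (g * (φ (x l))⁻¹)
        rw [inv_mul_cancel_right] at this
        rw [this, Bool.not_not]
  -- Otherwise a sign changed by both would give a flow on `i`, `l`, `σ l`. In particular involutory
  -- labels commute with the other labels in `P`.
  have hpz : ∀ i ∈ F, ∀ l ∈ s, σ l ≠ l → φ (x i) ∈ Subgroup.zpowers (φ (x l)) ∨
      φ (x l) ∈ Subgroup.zpowers (φ (x i)) := by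
    intro i hi l hl hll
    by_contra h
    rw [not_or] at h
    exact hpair i hi l hl hll (exists_sign_pair hP h.1 h.2)
  have hpc : ∀ i ∈ F, ∀ l ∈ s, σ l ≠ l → Commute (φ (x i)) (φ (x l)) := by
    intro i hi l hl hll
    rcases hpz i hi l hl hll with ⟨k, h⟩ | ⟨k, h⟩
    · exact h ▸ (Commute.refl _).zpow_left k
    · exact h ▸ (Commute.refl _).zpow_right k
  have hpne : ∀ i ∈ F, ∀ l ∈ s, σ l ≠ l → φ (x l) ≠ φ (x i) := by
    intro i hi l hl hll h
    refine hpair i hi l hl hll ?_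
    rw [h]
    exact exists_sign_involutions hP (hF2 i hi) (hF2 i hi) (hF1 i hi) (hF1 i hi)
  have htne : ∀ i ∈ F, ∀ j ∈ F, ∀ k ∈ F, i ≠ j → i ≠ k → j ≠ k → φ (x i) ≠ φ (x j) := by
    intro i hi j hj k hk hij hik hjk h
    obtain ⟨r, h1, h2⟩ :=
      exists_sign_involutions hP (hF2 i hi) (hF2 k hk) (hF1 i hi) (hF1 k hk)
    exact htri i hi j hj k hk hij hik hjk ⟨r, h1, h ▸ h1, h2⟩
  have hthree : ∀ i ∈ F, ∀ j ∈ F, ∀ k ∈ F, i ≠ j → i ≠ k → j ≠ k →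
      φ (x k) ∈ Subgroup.zpowers (φ (x i) * φ (x j)) ∨
      φ (x j) ∈ Subgroup.zpowers (φ (x i) * φ (x k)) ∨
      φ (x i) ∈ Subgroup.zpowers (φ (x j) * φ (x k)) := by
    intro i hi j hj k hk hij hik hjk
    exact (exists_sign_three hP (hF2 i hi) (hF2 j hj) (hF2 k hk) (hF1 i hi) (hF1 j hj)
      (hF1 k hk)).resolve_left (htri i hi j hj k hk hij hik hjk)
  have hcen : ∀ i ∈ F, ∀ t ⊆ s, t.card = 4 → i ∉ t → (∀ l ∈ t, σ l ∈ t) →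
      Even (t.filter fun i => σ i = i).card → (∀ l ∈ t, Commute (φ (x i)) (φ (x l))) →
      (∀ l ∈ t, φ (x l) ≠ 1 ∧ φ (x l) ≠ φ (x i)) → False := by
    intro i hi t hts ht hit hσt hev hcomm hne
    obtain ⟨his, hii⟩ := (memF i).1 hi
    refine hext (insert i t) (Finset.insert_subset his hts) (fun l hl => ?_) ?_
      (of_central ht hit hii hσt (fun l hl => hσσ l (hts hl)) (fun l hl => hy l (hts hl))
        (hF2 i hi) (hF1 i hi) hcomm hne)
    · rcases Finset.mem_insert.1 hl with rfl | hl
      · rw [hii]; exact hl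
      · exact Finset.mem_insert_of_mem (hσt l hl)
    · rw [Finset.filter_insert, if_pos hii, Finset.card_insert_of_notMem fun h =>
        hit (Finset.mem_filter.1 h).1, Nat.even_add_one]
      exact not_not.2 hev
  have hFs : ∀ i ∈ F, i ∈ s := fun i hi => ((memF i).1 hi).1
  have hFσ : ∀ i ∈ F, σ i = i := fun i hi => ((memF i).1 hi).2
  have hnF : ∀ i ∈ s, i ∉ F → σ i ≠ i := fun i hi h h' => h ((memF i).2 ⟨hi, h'⟩)
  rcases (by obtain ⟨k, hk⟩ := Nat.not_even_iff_odd.1 hpar; omega :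
    F.card = 1 ∨ F.card = 3 ∨ 5 ≤ F.card) with h1 | h3 | h5
  · obtain ⟨i, hi⟩ := Finset.card_eq_one.1 h1
    have hiF : i ∈ F := hi ▸ Finset.mem_singleton_self i
    have hns : ∀ l ∈ s, l ≠ i → σ l ≠ l := fun l hl hli =>
      hnF l hl (by rw [hi, Finset.mem_singleton]; exact hli)
    refine hcyc ?_
    -- With one involutory label `i`, two inverse pairs of nontrivial image would form a central
    -- block with it. So at most one such pair occurs; its image is comparable with that of `i`, and
    -- `P` would be cyclic.
    obtain ⟨w, hw⟩ : ∃ w : P, ∀ l ∈ s, φ (x l) ∈ Subgroup.zpowers w := by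
      by_cases hW : ∃ l ∈ s, l ≠ i ∧ φ (x l) ≠ 1
      · obtain ⟨l, hl, hli, hl1⟩ := hW
        have hll := hns l hl hli
        have hothers : ∀ k ∈ s, k ≠ i → k ≠ l → k ≠ σ l → φ (x k) = 1 := by
          intro k hk hki hkl hkl'
          by_contra hk1
          have hkk := hns k hk hki
          have e1 : l ≠ σ k := fun h => hkl' (by rw [h, hσσ k hk])
          have e2 : σ l ≠ σ k := fun h => hkl (by rw [← hσσ k hk, ← h, hσσ l hl])
          have hm : ∀ j ∈ ({l, σ l, k, σ k} : Finset ι), j ∈ s ∧ σ j ≠ j ∧ φ (x j) ≠ 1 := by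
            intro j hj
            simp only [Finset.mem_insert, Finset.mem_singleton] at hj
            rcases hj with rfl | rfl | rfl | rfl
            · exact ⟨hl, hll, hl1⟩
            · exact ⟨hσs l hl, by rw [hσσ l hl]; exact hll.symm, by
                rw [hy l hl]; exact inv_ne_one.2 hl1⟩
            · exact ⟨hk, hkk, hk1⟩
            · exact ⟨hσs k hk, by rw [hσσ k hk]; exact hkk.symm, by
                rw [hy k hk]; exact inv_ne_one.2 hk1⟩
          refine hcen i hiF {l, σ l, k, σ k} (fun j hj => (hm j hj).1) ?_
            (fun h => (hm i h).2.1 (hFσ i hiF)) (fun j hj => ?_) ?_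
            (fun j hj => hpc i hiF j (hm j hj).1 (hm j hj).2.1)
            fun j hj => ⟨(hm j hj).2.2, hpne i hiF j (hm j hj).1 (hm j hj).2.1⟩
          · rw [Finset.card_insert_of_notMem (by simp [hll.symm, hkl.symm, e1]),
              Finset.card_insert_of_notMem (by simp [hkl'.symm, e2]), Finset.card_pair hkk.symm]
          · simp only [Finset.mem_insert, Finset.mem_singleton] at hj ⊢
            rcases hj with rfl | rfl | rfl | rfl
            · simp
            · simp [hσσ l hl]
            · simp
            · simp [hσσ k hk]
          · rw [Finset.filter_false_of_mem fun j hj => (hm j hj).2.1]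
            simp
        have hmemσ : ∀ w, φ (x l) ∈ Subgroup.zpowers w → φ (x i) ∈ Subgroup.zpowers w →
            ∀ k ∈ s, φ (x k) ∈ Subgroup.zpowers w := by
          intro w h1 h2 k hk
          by_cases hki : k = i
          · rwa [hki]
          by_cases hkl : k = l
          · rwa [hkl]
          by_cases hkl' : k = σ l
          · rw [hkl', hy l hl]; exact inv_mem h1
          rw [hothers k hk hki hkl hkl']
          exact one_mem _
        rcases hpz i hiF l hl hll with h | h
        · exact ⟨_, hmemσ _ (Subgroup.mem_zpowers _) h⟩
        · exact ⟨_, hmemσ _ h (Subgroup.mem_zpowers _)⟩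
      · refine ⟨φ (x i), fun l hl => ?_⟩
        by_cases hli : l = i
        · rw [hli]; exact Subgroup.mem_zpowers _
        · rw [not_exists] at hW
          have : φ (x l) = 1 := by
            by_contra h
            exact hW l ⟨hl, hli, h⟩
          rw [this]
          exact one_mem _
    have htop : Subgroup.zpowers w = ⊤ := by
      rw [eq_top_iff, ← hgen, Subgroup.closure_le]
      rintro _ ⟨l, hl, rfl⟩
      exact hw l hl
    refine ⟨w, fun g => ?_⟩
    have : g ∈ Subgroup.zpowers w := by rw [htop]; exact Subgroup.mem_top g
    exact this
  · obtain ⟨a, b, c, hab, hac, hbc, hFe, hz⟩ : ∃ a b c, a ≠ b ∧ a ≠ c ∧ b ≠ c ∧ F = {a, b, c} ∧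
        φ (x c) ∈ Subgroup.zpowers (φ (x a) * φ (x b)) := by
      obtain ⟨i, j, k, hij, hik, hjk, hF3⟩ := Finset.card_eq_three.1 h3
      rcases hthree i (by simp [hF3]) j (by simp [hF3]) k (by simp [hF3]) hij hik hjk with
        h | h | h
      · exact ⟨i, j, k, hij, hik, hjk, hF3, h⟩
      · exact ⟨i, k, j, hik, hij, hjk.symm, by rw [hF3]; congr 1; exact Finset.pair_comm _ _, h⟩
      · refine ⟨j, k, i, hjk, hij.symm, hik.symm, ?_, h⟩
        rw [hF3]
        ext l
        simp only [Finset.mem_insert, Finset.mem_singleton]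
        tauto
    have haF : a ∈ F := by simp [hFe]
    have hbF : b ∈ F := by simp [hFe]
    have hcF : c ∈ F := by simp [hFe]
    obtain ⟨hca, hcb⟩ := commute_of_mem_zpowers_mul (hF2 a haF) (hF2 b hbF) (hF2 c hcF) hz
    refine hexc ⟨a, b, c, hab, hac, hbc, hFe, hz, fun l hl hll => ?_⟩
    by_contra hl1
    have hlF : ∀ j ∈ F, j ≠ l ∧ j ≠ σ l := fun j hj => ⟨fun h => hll (h ▸ hFσ j hj), fun h => by
      have := hFσ j hj
      rw [h, hσσ l hl] at this
      exact hll this.symm⟩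
    -- The involution `c` commutes with `a` and `b`, being a power of their product, and with `l`.
    -- An inverse pair of nontrivial image would thus complete a central block.
    have hm : ∀ j ∈ ({a, b, l, σ l} : Finset ι), j ∈ s ∧ Commute (φ (x c)) (φ (x j)) ∧
        φ (x j) ≠ 1 ∧ φ (x j) ≠ φ (x c) := by
      intro j hj
      have hl' : σ (σ l) ≠ σ l := by rw [hσσ l hl]; exact hll.symm
      simp only [Finset.mem_insert, Finset.mem_singleton] at hj
      rcases hj with rfl | rfl | rfl | rfl
      · exact ⟨hFs _ haF, hca, hF1 _ haF, htne _ haF _ hcF _ hbF hac hab hbc.symm⟩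
      · exact ⟨hFs _ hbF, hcb, hF1 _ hbF, htne _ hbF _ hcF _ haF hbc hab.symm hac.symm⟩
      · exact ⟨hl, hpc _ hcF _ hl hll, hl1, hpne _ hcF _ hl hll⟩
      · exact ⟨hσs l hl, hpc _ hcF _ (hσs l hl) hl', by
          rw [hy l hl]; exact inv_ne_one.2 hl1, hpne _ hcF _ (hσs l hl) hl'⟩
    refine hcen c hcF {a, b, l, σ l} (fun j hj => (hm j hj).1) ?_
      (by simp [hac.symm, hbc.symm, hlF c hcF]) (fun j hj => ?_) ?_ (fun j hj => (hm j hj).2.1)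
      fun j hj => (hm j hj).2.2
    · rw [Finset.card_insert_of_notMem (by simp [hab, hlF a haF]),
        Finset.card_insert_of_notMem (by simp [hlF b hbF]), Finset.card_pair hll.symm]
    · simp only [Finset.mem_insert, Finset.mem_singleton] at hj ⊢
      rcases hj with rfl | rfl | rfl | rfl
      · simp [hFσ _ haF]
      · simp [hFσ _ hbF]
      · simp
      · simp [hσσ l hl]
    · have : ({a, b, l, σ l} : Finset ι).filter (fun i => σ i = i) = {a, b} := by
        ext j
        simp only [Finset.mem_filter, Finset.mem_insert, Finset.mem_singleton]
        constructor
        · rintro ⟨rfl | rfl | rfl | rfl, h⟩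
          · exact Or.inl rfl
          · exact Or.inr rfl
          · exact absurd h hll
          · rw [hσσ l hl] at h
            exact absurd h.symm hll
        · rintro (rfl | rfl)
          · exact ⟨Or.inl rfl, hFσ _ haF⟩
          · exact ⟨Or.inr (Or.inl rfl), hFσ _ hbF⟩
      rw [this, Finset.card_pair hab]
      decide
  · obtain ⟨F', hF'F, hF'5⟩ := Finset.exists_subset_card_eq h5
    have hcomm3 : ∀ i ∈ F', ∀ j ∈ F', ∀ k ∈ F', i ≠ j → i ≠ k → j ≠ k →
        (Commute (φ (x k)) (φ (x i)) ∧ Commute (φ (x k)) (φ (x j))) ∨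
        (Commute (φ (x j)) (φ (x i)) ∧ Commute (φ (x j)) (φ (x k))) ∨
        (Commute (φ (x i)) (φ (x j)) ∧ Commute (φ (x i)) (φ (x k))) := by
      intro i hi j hj k hk hij hik hjk
      replace hi := hF'F hi
      replace hj := hF'F hj
      replace hk := hF'F hk
      rcases hthree i hi j hj k hk hij hik hjk with h | h | h
      · exact Or.inl (commute_of_mem_zpowers_mul (hF2 i hi) (hF2 j hj) (hF2 k hk) h)
      · exact Or.inr (Or.inl (commute_of_mem_zpowers_mul (hF2 i hi) (hF2 k hk) (hF2 j hj) h))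
      · exact Or.inr (Or.inr (commute_of_mem_zpowers_mul (hF2 j hj) (hF2 k hk) (hF2 i hi) h))
    -- In every triple some member commutes with the other two. If `p` and `q` do not commute, the
    -- other three labels commute with both of them, and one of these three commutes with the
    -- remaining two.
    obtain ⟨c, hc, hcc⟩ : ∃ c ∈ F', ∀ j ∈ F', Commute (φ (x c)) (φ (x j)) := by
      by_cases hall : ∃ p ∈ F', ∃ q ∈ F', ¬ Commute (φ (x p)) (φ (x q))
      · obtain ⟨p, hp, q, hq, hpq⟩ := hall
        have hpq' : p ≠ q := fun h => hpq (h ▸ Commute.refl _)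
        have hqp : ¬ Commute (φ (x q)) (φ (x p)) := fun h => hpq h.symm
        have hsub : ({p, q} : Finset ι) ⊆ F' := by
          intro j hj
          rcases Finset.mem_insert.1 hj with rfl | hj
          · exact hp
          · rwa [Finset.mem_singleton.1 hj]
        have hcard : (F' \ {p, q}).card = 3 := by
          rw [Finset.card_sdiff_of_subset hsub, Finset.card_pair hpq', hF'5]
        obtain ⟨u, v, w, huv, huw, hvw, he⟩ := Finset.card_eq_three.1 hcard
        have hin : ∀ j, j = u ∨ j = v ∨ j = w → j ∈ F' ∧ j ≠ p ∧ j ≠ q := by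
          intro j hj
          have : j ∈ F' \ {p, q} := by simpa [he] using hj
          simpa [not_or] using this
        have hcov : ∀ j ∈ F', j = p ∨ j = q ∨ j = u ∨ j = v ∨ j = w := by
          intro j hj
          by_cases hjp : j = p
          · exact Or.inl hjp
          by_cases hjq : j = q
          · exact Or.inr (Or.inl hjq)
          have : j ∈ F' \ {p, q} := by simp [hj, hjp, hjq]
          rw [he] at this
          exact Or.inr (Or.inr (by simpa using this))
        have hpqc : ∀ j, j = u ∨ j = v ∨ j = w →
            Commute (φ (x j)) (φ (x p)) ∧ Commute (φ (x j)) (φ (x q)) := by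
          intro j hj
          obtain ⟨h1, h2, h3⟩ := hin j hj
          rcases hcomm3 p hp q hq j h1 hpq' h2.symm h3.symm with h | h | h
          · exact h
          · exact absurd h.1 hqp
          · exact absurd h.1 hpq
        have hu := hin u (by simp)
        have hv := hin v (by simp)
        have hw := hin w (by simp)
        have hu' := hpqc u (by simp)
        have hv' := hpqc v (by simp)
        have hw' := hpqc w (by simp)
        rcases hcomm3 u hu.1 v hv.1 w hw.1 huv huw hvw with h | h | h
        · refine ⟨w, hw.1, fun j hj => ?_⟩
          rcases hcov j hj with rfl | rfl | rfl | rfl | rfl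
          exacts [hw'.1, hw'.2, h.1, h.2, Commute.refl _]
        · refine ⟨v, hv.1, fun j hj => ?_⟩
          rcases hcov j hj with rfl | rfl | rfl | rfl | rfl
          exacts [hv'.1, hv'.2, h.1, Commute.refl _, h.2]
        · refine ⟨u, hu.1, fun j hj => ?_⟩
          rcases hcov j hj with rfl | rfl | rfl | rfl | rfl
          exacts [hu'.1, hu'.2, Commute.refl _, h.1, h.2]
      · obtain ⟨c, hc⟩ : F'.Nonempty := Finset.card_pos.1 (by omega)
        refine ⟨c, hc, fun j hj => ?_⟩
        by_contra h
        exact hall ⟨c, hc, j, hj, h⟩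
    have ht : ∀ l ∈ F'.erase c, l ≠ c ∧ l ∈ F := fun l hl =>
      ⟨(Finset.mem_erase.1 hl).1, hF'F (Finset.mem_erase.1 hl).2⟩
    have hcard : (F'.erase c).card = 4 := by rw [Finset.card_erase_of_mem hc, hF'5]
    refine hcen c (hF'F hc) (F'.erase c) (fun l hl => hFs l (ht l hl).2) hcard
      (Finset.notMem_erase c F') (fun l hl => by rwa [hFσ l (ht l hl).2]) ?_
      (fun l hl => hcc l (Finset.mem_erase.1 hl).2) fun l hl => ⟨hF1 l (ht l hl).2, ?_⟩
    · rw [Finset.filter_true_of_mem fun l hl => hFσ l (ht l hl).2, hcard]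
      decide
    · obtain ⟨k, hk, hkl⟩ := Finset.exists_mem_ne (s := F'.erase c) (by omega) l
      exact htne l (ht l hl).2 c (hF'F hc) k (ht k hk).2 (ht l hl).1 hkl.symm (ht k hk).1.symm

end HasFlow

/-! ### Normal cyclic subgroups -/

section Cyclic

variable {G : Type*} [Group G]

theorem zpowers_normal_iff {z : G} :
    (Subgroup.zpowers z).Normal ↔ ∀ g, ∃ k : ℤ, g * z * g⁻¹ = z ^ k := by
  constructor
  · intro h g
    obtain ⟨k, hk⟩ := h.conj_mem z (Subgroup.mem_zpowers z) g
    exact ⟨k, hk.symm⟩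
  · intro h
    refine ⟨fun w hw g => ?_⟩
    obtain ⟨j, rfl⟩ := hw
    obtain ⟨k, hk⟩ := h g
    beta_reduce
    rw [← conj_zpow, hk]
    exact Subgroup.zpow_mem _ (Subgroup.zpow_mem_zpowers _ _) _

theorem zpowers_pow_normal {z : G} (h : (Subgroup.zpowers z).Normal) (m : ℕ) :
    (Subgroup.zpowers (z ^ m)).Normal := by
  rw [zpowers_normal_iff] at h ⊢
  intro g
  obtain ⟨k, hk⟩ := h g
  refine ⟨k, ?_⟩
  rw [← conj_pow, hk, ← zpow_natCast, ← zpow_natCast, ← zpow_mul, ← zpow_mul, mul_comm]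

/-- Conjugation by `u` raises `z` to some power `k`, and `u * u = 1` makes the prime order of `z`
divide `k * k - 1`. -/
theorem conj_eq_or_eq_inv {z u : G} (hz : (Subgroup.zpowers z).Normal) (hp : (orderOf z).Prime)
    (hu : u * u = 1) : u * z * u⁻¹ = z ∨ u * z * u⁻¹ = z⁻¹ := by
  obtain ⟨k, hk⟩ := zpowers_normal_iff.1 hz u
  have h1 : z ^ (k * k) = z := by
    rw [zpow_mul, ← hk, conj_zpow, ← hk]
    simp only [mul_assoc]
    rw [← mul_inv_rev, hu, ← mul_assoc u, hu]
    simp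
  have h2 : z ^ (k * k - 1) = 1 := by rw [zpow_sub_one, h1, mul_inv_cancel]
  rw [← orderOf_dvd_iff_zpow_eq_one] at h2
  have h3 : k * k - 1 = (k - 1) * (k + 1) := by ring
  rw [h3] at h2
  rcases (Nat.prime_iff_prime_int.1 hp).dvd_or_dvd h2 with h | h
  · left
    rw [orderOf_dvd_iff_zpow_eq_one, zpow_sub_one, mul_inv_eq_one] at h
    rw [hk, h]
  · right
    rw [orderOf_dvd_iff_zpow_eq_one, zpow_add_one, mul_eq_one_iff_eq_inv] at h
    rw [hk, h]

theorem conj_eq_or_eq_inv_of_mem_closure {z u v d : G}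
    (hu : u * z * u⁻¹ = z ∨ u * z * u⁻¹ = z⁻¹) (hv : v * z * v⁻¹ = z ∨ v * z * v⁻¹ = z⁻¹)
    (hd : d ∈ Subgroup.closure {u, v}) : d * z * d⁻¹ = z ∨ d * z * d⁻¹ = z⁻¹ := by
  induction hd using Subgroup.closure_induction with
  | mem y hy =>
    rcases hy with rfl | rfl
    exacts [hu, hv]
  | one => simp
  | mul y w _ _ h1 h2 =>
    have e : y * w * z * (y * w)⁻¹ = y * (w * z * w⁻¹) * y⁻¹ := by group
    rw [e]
    rcases h2 with h2 | h2
    · rw [h2]; exact h1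
    · rw [h2, ← conj_inv]
      rcases h1 with h1 | h1
      · right; rw [h1]
      · left; rw [h1, inv_inv]
  | inv y _ h1 =>
    rw [inv_inv]
    rcases h1 with h1 | h1
    · left
      conv_lhs => rw [← h1]
      group
    · right
      have h2 : z⁻¹ = y * z * y⁻¹ := h1.symm
      have h3 : z = y * z⁻¹ * y⁻¹ := by rw [← conj_inv, h1, inv_inv]
      conv_lhs => rw [h3]
      group

theorem conj_eq_inv_of_mem_zpowers_mul {a b w : G} (ha : a * a = 1) (hb : b * b = 1)
    (h : w ∈ Subgroup.zpowers (a * b)) : a * w * a⁻¹ = w⁻¹ ∧ b * w * b⁻¹ = w⁻¹ := by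
  have ha' : a⁻¹ = a := inv_eq_of_mul_eq_one_left ha
  have hb' : b⁻¹ = b := inv_eq_of_mul_eq_one_left hb
  obtain ⟨k, rfl⟩ := h
  beta_reduce
  constructor
  · rw [← conj_zpow, ← inv_zpow]
    congr 1
    rw [mul_inv_rev, ha', hb', ← mul_assoc a a, ha, one_mul]
  · rw [← conj_zpow, ← inv_zpow]
    congr 1
    rw [mul_inv_rev, ha', hb', mul_assoc, mul_assoc, hb, mul_one]

/-- The square of `n` centralizes `z`, and `n` is the inverse of a power of its square because its
order is odd. -/
theorem conj_inv_contradiction {z n : G} (hz : z * z ≠ 1) (hn : Odd (orderOf n))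
    (h : n * z * n⁻¹ = z⁻¹) : False := by
  have key : ∀ k : ℕ, n ^ (2 * k) * z * (n ^ (2 * k))⁻¹ = z := by
    intro k
    induction k with
    | zero => simp
    | succ k ih =>
      have e : n ^ (2 * (k + 1)) * z * (n ^ (2 * (k + 1)))⁻¹ =
          n * (n * (n ^ (2 * k) * z * (n ^ (2 * k))⁻¹) * n⁻¹) * n⁻¹ := by
        have : n ^ (2 * (k + 1)) = n * n * n ^ (2 * k) := by
          rw [mul_add, pow_add, mul_one, pow_two, (Commute.refl n).mul_left (Commute.refl n)
            |>.pow_right _ |>.eq]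
        rw [this]
        group
      rw [e, ih, h, ← conj_inv, h, inv_inv]
  obtain ⟨k, hk⟩ := hn
  have h1 := pow_orderOf_eq_one n
  rw [hk, pow_succ] at h1
  have h2 : n ^ (2 * k) = n⁻¹ := eq_inv_of_mul_eq_one_left h1
  have h3 := key k
  rw [h2] at h3
  have h4 : z = n * z * n⁻¹ := by
    conv_rhs => rw [← h3]
    group
  rw [h] at h4
  exact hz (by rw [mul_eq_one_iff_eq_inv]; exact h4)

end Cyclic

/-! ### The exceptional configuration -/

namespace HasFlow

variable {G P ι : Type*} [Group G] [Group P] [DecidableEq ι] {x : ι → G} {σ : ι → ι}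

/-- The grid needs `⟨x d⟩` to meet `⟨x a, x c⟩` trivially or, after exchanging `a` and `b`, `⟨x b, x
c⟩`. If both fail, all three involutions invert `x d`. Then `x a * x b` centralizes it, and `x c`, a
power of this product up to an element of odd order, cannot invert it. -/
theorem of_prime_order [Finite P] (hP : IsPGroup 2 P) (φ : G →* P)
    (hker : ∀ g, φ g = 1 → Odd (orderOf g)) {a b c d : ι} (hab : a ≠ b) (hac : a ≠ c)
    (hbc : b ≠ c) (ha : σ a = a) (hb : σ b = b) (hc : σ c = c) (hd : σ d ≠ d)
    (hdd : σ (σ d) = d) (hx : x (σ d) = (x d)⁻¹) (ha2 : x a * x a = 1) (hb2 : x b * x b = 1)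
    (hc2 : x c * x c = 1) (ha1 : φ (x a) ≠ 1) (hb1 : φ (x b) ≠ 1) (hc1 : φ (x c) ≠ 1)
    (hz : φ (x c) ∈ Subgroup.zpowers (φ (x a) * φ (x b))) (hd0 : φ (x d) = 1)
    (hnorm : (Subgroup.zpowers (x d)).Normal) (hprime : (orderOf (x d)).Prime) :
    HasFlow x σ {a, b, c, d, σ d} := by
  have sq : ∀ {u : G}, u * u = 1 → φ u * φ u = 1 := fun h => by rw [← map_mul, h, map_one]
  have hodd := hker _ hd0
  have hzz : x d * x d ≠ 1 := by
    intro h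
    rw [← pow_two] at h
    have h1 := (Nat.dvd_prime Nat.prime_two).1 (orderOf_dvd_of_pow_eq_one h)
    rcases h1 with h1 | h1
    · exact hprime.one_lt.ne' h1
    · rw [h1] at hodd
      exact absurd hodd (by decide)
  have inverts : ∀ u v : G, u * u = 1 → v * v = 1 → φ u ≠ 1 → φ v ≠ 1 →
      ¬ Disjoint (Subgroup.zpowers (x d)) (Subgroup.closure {u, v}) →
      u * x d * u⁻¹ = (x d)⁻¹ ∧ v * x d * v⁻¹ = (x d)⁻¹ := by
    intro u v hu hv hu1 hv1 hdis
    refine conj_eq_inv_of_mem_zpowers_mul hu hv ?_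
    have hmem : x d ∈ Subgroup.closure {u, v} := by
      rw [Subgroup.disjoint_def] at hdis
      push Not at hdis
      obtain ⟨w, ⟨k, rfl⟩, hw, hw1⟩ := hdis
      beta_reduce at hw hw1
      have hcop : IsCoprime k (orderOf (x d) : ℤ) := by
        rw [isCoprime_comm, (Nat.prime_iff_prime_int.1 hprime).coprime_iff_not_dvd]
        exact fun h => hw1 (orderOf_dvd_iff_zpow_eq_one.1 h)
      obtain ⟨r, t, hrt⟩ := hcop
      have e : x d = (x d ^ k) ^ r := by
        conv_lhs => rw [← zpow_one (x d), ← hrt, zpow_add, mul_comm r k, zpow_mul, mul_comm t,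
          zpow_mul, zpow_natCast, pow_orderOf_eq_one, one_zpow, mul_one]
      rw [e]
      exact Subgroup.zpow_mem _ hw _
    -- If `x d * u` were a rotation, a sign changed by `u` and `v` would be kept by it; but `x d` is
    -- trivial in `P` and `u` changes the sign.
    refine (mem_closure_involutions hu hv hmem).resolve_right fun h => ?_
    obtain ⟨s, hs1, hs2⟩ := exists_sign_involutions hP (sq hu) (sq hv) hu1 hv1
    have h1 := sign_mul_of_mem_zpowers_mul (s := fun g => s (φ g)) (fun g => by simp [hs1])
      (fun g => by simp [hs2]) h 1
    simp [hd0] at h1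
    have h2 := hs1 1
    rw [one_mul] at h2
    rw [h2] at h1
    simp at h1
  have grid : ∀ a b c : ι, a ≠ b → a ≠ c → b ≠ c → σ a = a → σ b = b → σ c = c →
      x a * x a = 1 → x b * x b = 1 → x c * x c = 1 → φ (x a) ≠ 1 → φ (x b) ≠ 1 →
      φ (x c) ≠ 1 → (∃ s : P → Bool, (∀ g, s (g * φ (x a)) = !s g) ∧
        (∀ g, s (g * φ (x b)) = !s g) ∧ ∀ g, s (g * φ (x c)) = s g) →
      Disjoint (Subgroup.zpowers (x d)) (Subgroup.closure {x a, x c}) →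
      HasFlow x σ {a, b, c, d, σ d} := by
    rintro a b c hab hac hbc ha hb hc ha2 hb2 hc2 ha1 hb1 hc1 ⟨s, hsa, hsb, hsc⟩ hdis
    obtain ⟨δ, hδa, hδc⟩ := exists_sign_involutions hP (sq ha2) (sq hc2) ha1 hc1
    obtain ⟨J, r, hJ, hJd, hr⟩ := exists_cyclic_coordinate (x d)
      (Subgroup.closure {x a, x c}) (fun e he => conj_eq_or_eq_inv_of_mem_closure
        (conj_eq_or_eq_inv hnorm hprime ha2) (conj_eq_or_eq_inv hnorm hprime hc2) he) hdis
    exact of_grid hab hac hbc ha hb hc hd hdd hx hodd hprime.one_lt.ne'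
      (fun g => s (φ g)) (fun g => δ (φ g)) J r (fun g => by rw [map_mul, hsa])
      (fun g => by rw [map_mul, hsb]) (fun g => by rw [map_mul, hsc])
      (fun g => by rw [map_mul, hd0, mul_one]) (fun g => by rw [map_mul, hδa])
      (fun g => by rw [map_mul, hδc]) (fun g => by rw [map_mul, hd0, mul_one])
      (fun g => hJ g _ (Subgroup.subset_closure (by simp)))
      (fun g => hJ g _ (Subgroup.subset_closure (by simp))) hJd hr
  obtain ⟨s, hsa, hsb⟩ := exists_sign_involutions hP (sq ha2) (sq hb2) ha1 hb1
  have hsc := sign_mul_of_mem_zpowers_mul hsa hsb hz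
  by_cases h1 : Disjoint (Subgroup.zpowers (x d)) (Subgroup.closure {x a, x c})
  · exact grid a b c hab hac hbc ha hb hc ha2 hb2 hc2 ha1 hb1 hc1 ⟨s, hsa, hsb, hsc⟩ h1
  by_cases h2 : Disjoint (Subgroup.zpowers (x d)) (Subgroup.closure {x b, x c})
  · rw [Finset.insert_comm]
    exact grid b a c hab.symm hbc hac hb ha hc hb2 ha2 hc2 hb1 ha1 hc1 ⟨s, hsb, hsa, hsc⟩ h2
  exfalso
  obtain ⟨ia, ic⟩ := inverts _ _ ha2 hc2 ha1 hc1 h1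
  obtain ⟨ib, -⟩ := inverts _ _ hb2 hc2 hb1 hc1 h2
  obtain ⟨k, hk⟩ := hz
  beta_reduce at hk
  have hcomm : Commute (x a * x b) (x d) := by
    have e : x a * x b * x d * (x a * x b)⁻¹ = x d := by
      have : x a * x b * x d * (x a * x b)⁻¹ = x a * (x b * x d * (x b)⁻¹) * (x a)⁻¹ := by group
      rw [this, ib, ← conj_inv, ia, inv_inv]
    exact mul_inv_eq_iff_eq_mul.1 e
  have hn : φ (((x a * x b) ^ k)⁻¹ * x c) = 1 := by
    rw [map_mul, map_inv, map_zpow, map_mul, hk, inv_mul_cancel]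
  refine conj_inv_contradiction hzz (hker _ hn) ?_
  have hcomm' : Commute ((x a * x b) ^ k)⁻¹ (x d)⁻¹ := (hcomm.zpow_left k).inv_inv
  have e : ((x a * x b) ^ k)⁻¹ * x c * x d * (((x a * x b) ^ k)⁻¹ * x c)⁻¹ =
      ((x a * x b) ^ k)⁻¹ * (x c * x d * (x c)⁻¹) * (x a * x b) ^ k := by group
  rw [e, ic, hcomm'.eq, inv_mul_cancel_right]

/-- The exceptional configuration carries a flow if conjugation maps `x d` to its powers modulo
a normal subgroup not containing it. -/
theorem of_normal_cyclic [Finite G] [Finite P] (hP : IsPGroup 2 P) (φ : G →* P)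
    (hker : ∀ g, φ g = 1 → Odd (orderOf g)) {a b c d : ι} (hab : a ≠ b) (hac : a ≠ c)
    (hbc : b ≠ c) (ha : σ a = a) (hb : σ b = b) (hc : σ c = c) (hd : σ d ≠ d)
    (hdd : σ (σ d) = d) (hx : x (σ d) = (x d)⁻¹) (ha2 : x a * x a = 1) (hb2 : x b * x b = 1)
    (hc2 : x c * x c = 1) (ha1 : φ (x a) ≠ 1) (hb1 : φ (x b) ≠ 1) (hc1 : φ (x c) ≠ 1)
    (hz : φ (x c) ∈ Subgroup.zpowers (φ (x a) * φ (x b))) (hd0 : φ (x d) = 1)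
    (H : Subgroup G) [H.Normal] (hdH : x d ∉ H)
    (hconj : ∀ g, ∃ k : ℤ, g * x d * g⁻¹ * (x d ^ k)⁻¹ ∈ H) :
    HasFlow x σ {a, b, c, d, σ d} := by
  -- Modulo `S` the image of `x d` is nontrivial and generates a normal subgroup, and `φ` still
  -- factors through the quotient.
  let S := φ.ker ⊓ H
  have sq : ∀ {L : Subgroup G} [L.Normal] {u : G}, u * u = 1 → (u : G ⧸ L) * (u : G ⧸ L) = 1 :=
    fun h => by rw [← QuotientGroup.mk_mul, h, QuotientGroup.mk_one]
  have lift_ker : ∀ (L : Subgroup G) [L.Normal] (hL : ∀ g ∈ L, φ g = 1) (g : G ⧸ L),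
      QuotientGroup.lift L φ hL g = 1 → Odd (orderOf g) := by
    intro L _ hL g hg
    obtain ⟨g, rfl⟩ := QuotientGroup.mk_surjective g
    exact (hker g hg).of_dvd_nat (orderOf_map_dvd (QuotientGroup.mk' L) g)
  have hSn : S.Normal := inferInstanceAs (φ.ker ⊓ H).Normal
  let z : G ⧸ S := QuotientGroup.mk' S (x d)
  have hz1 : z ≠ 1 := fun h => hdH ((QuotientGroup.eq_one_iff _).1 h).2
  have hznorm : (Subgroup.zpowers z).Normal := by
    rw [zpowers_normal_iff]
    intro g
    obtain ⟨g, rfl⟩ := QuotientGroup.mk_surjective g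
    obtain ⟨k, hk⟩ := hconj g
    refine ⟨k, ?_⟩
    rw [← mul_inv_eq_one]
    refine (QuotientGroup.eq_one_iff (g * x d * g⁻¹ * (x d ^ k)⁻¹)).2 ⟨?_, hk⟩
    simp [hd0]
  have hS : ∀ g ∈ S, φ g = 1 := fun g hg => hg.1
  have hord : orderOf z ≠ 1 := fun h => hz1 (orderOf_eq_one_iff.1 h)
  set p := (orderOf z).minFac with hp
  have hpp : p.Prime := Nat.minFac_prime hord
  have hRnorm := zpowers_pow_normal hznorm p
  -- Factoring out `z ^ p` as well reduces the order of the image of `x d` to the prime `p`.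
  let R := (Subgroup.zpowers (z ^ p)).comap (QuotientGroup.mk' S)
  have hR : ∀ g ∈ R, φ g = 1 := by
    rintro g ⟨k, hk⟩
    have h1 : QuotientGroup.lift S φ hS ((z ^ p) ^ k) = 1 := by
      rw [map_zpow, map_pow]
      have : QuotientGroup.lift S φ hS z = 1 := hd0
      rw [this, one_pow, one_zpow]
    beta_reduce at hk
    rw [hk] at h1
    exact h1
  refine of_hom (QuotientGroup.mk' R) (of_prime_order hP (QuotientGroup.lift R φ hR)
    (lift_ker R hR) hab hac hbc ha hb hc hd hdd (by rw [hx, map_inv]) (sq ha2) (sq hb2) (sq hc2)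
    ha1 hb1 hc1 hz hd0 ?_ ?_)
  · rw [zpowers_normal_iff]
    intro g
    obtain ⟨g, rfl⟩ := QuotientGroup.mk_surjective g
    obtain ⟨k, hk⟩ := zpowers_normal_iff.1 hznorm g
    refine ⟨k, ?_⟩
    rw [← mul_inv_eq_one]
    refine (QuotientGroup.eq_one_iff (g * x d * g⁻¹ * (x d ^ k)⁻¹)).2 ?_
    have : QuotientGroup.mk' S (g * x d * g⁻¹ * (x d ^ k)⁻¹) = 1 := by
      simp only [map_mul, map_inv, map_zpow]
      rw [mul_inv_eq_one]
      exact hk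
    change QuotientGroup.mk' S (g * x d * g⁻¹ * (x d ^ k)⁻¹) ∈ Subgroup.zpowers (z ^ p)
    rw [this]
    exact one_mem _
  · have h1 : orderOf (QuotientGroup.mk' R (x d)) ∣ p := by
      rw [orderOf_dvd_iff_pow_eq_one, ← map_pow]
      exact (QuotientGroup.eq_one_iff (x d ^ p)).2 (Subgroup.mem_zpowers (z ^ p))
    rcases (Nat.dvd_prime hpp).1 h1 with h2 | h2
    · exfalso
      rw [orderOf_eq_one_iff] at h2
      obtain ⟨k, hk⟩ : z ∈ Subgroup.zpowers (z ^ p) := (QuotientGroup.eq_one_iff (x d)).1 h2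
      beta_reduce at hk
      have h3 : (orderOf z : ℤ) ∣ p * k - 1 := by
        rw [orderOf_dvd_iff_zpow_eq_one, zpow_sub_one, zpow_mul, zpow_natCast, hk, mul_inv_cancel]
      have h4 : (p : ℤ) ∣ 1 := by
        have h5 : (p : ℤ) ∣ p * k - 1 :=
          (Int.natCast_dvd_natCast.2 (Nat.minFac_dvd _)).trans h3
        have := (Dvd.intro k rfl : (p : ℤ) ∣ p * k).sub h5
        simpa using this
      have := Int.natCast_dvd_natCast.1 (by simpa using h4 : (p : ℤ) ∣ (1 : ℕ))
      exact hpp.one_lt.ne' (Nat.dvd_one.1 this)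
    · rw [h2]
      exact hpp

end HasFlow

/-! ### Supersolvable groups -/

section Supersolvable

variable {G : Type*} [Group G]

/-- An automorphism of the cyclic group `K / H` raises its generator, and hence every element, to
one fixed power. -/
theorem exists_conj_mul_zpow_inv_mem {H K : Subgroup G} [H.Normal] [K.Normal]
    (hcyc : IsCyclic (K ⧸ H.subgroupOf K)) {z : G} (hz : z ∈ K) (g : G) :
    ∃ k : ℤ, g * z * g⁻¹ * (z ^ k)⁻¹ ∈ H := by
  obtain ⟨q, hq⟩ := hcyc.exists_generator
  obtain ⟨y, rfl⟩ := QuotientGroup.mk_surjective q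
  have hgen : ∀ w ∈ K, ∃ j : ℤ, (QuotientGroup.mk' H w) = QuotientGroup.mk' H (y : G) ^ j := by
    intro w hw
    obtain ⟨j, hj⟩ := hq (QuotientGroup.mk ⟨w, hw⟩)
    refine ⟨j, ?_⟩
    beta_reduce at hj
    rw [← QuotientGroup.mk_zpow, QuotientGroup.eq, Subgroup.mem_subgroupOf] at hj
    rw [← map_zpow]
    refine (QuotientGroup.eq.2 ?_).symm
    simpa using hj
  obtain ⟨j, hj⟩ := hgen z hz
  obtain ⟨k, hk⟩ := hgen (g * y * g⁻¹) (Subgroup.Normal.conj_mem ‹_› _ y.2 g)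
  refine ⟨k, ?_⟩
  refine (QuotientGroup.eq_one_iff (g * z * g⁻¹ * (z ^ k)⁻¹)).1 ?_
  change QuotientGroup.mk' H (g * z * g⁻¹ * (z ^ k)⁻¹) = 1
  simp only [map_mul, map_inv, map_zpow] at hk ⊢
  rw [mul_inv_eq_one, hj, ← conj_zpow, hk, ← zpow_mul, ← zpow_mul, mul_comm]

/-- Nontrivial finite images of supersolvable groups have normal subgroups of prime order. -/
theorem IsSupersolvableGroup.exists_normal_zpowers (hG : IsSupersolvableGroup G) {H : Type*}
    [Group H] [Finite H] [Nontrivial H] (φ : G →* H) (hφ : Function.Surjective φ) :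
    ∃ z : H, (orderOf z).Prime ∧ (Subgroup.zpowers z).Normal := by
  classical
  obtain ⟨n, K, hK, h0, hn, hcyc⟩ := hG
  -- In the first term of the series with nontrivial image, conjugates are powers modulo the
  -- previous term, which `φ` kills.
  have hex : ∃ i, ¬ K i ≤ φ.ker := by
    refine ⟨n, fun h => ?_⟩
    obtain ⟨w, hw⟩ := exists_ne (1 : H)
    obtain ⟨g, rfl⟩ := hφ w
    exact hw (h (hn ▸ Subgroup.mem_top g))
  have hspec := Nat.find_spec hex
  have hmin : ∀ j < Nat.find hex, K j ≤ φ.ker := fun j hj => not_not.1 (Nat.find_min hex hj)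
  have hle : Nat.find hex ≤ n := by
    refine Nat.find_min' hex fun h => ?_
    obtain ⟨w, hw⟩ := exists_ne (1 : H)
    obtain ⟨g, rfl⟩ := hφ w
    exact hw (h (hn ▸ Subgroup.mem_top g))
  generalize Nat.find hex = m at hspec hmin hle
  obtain _ | i := m
  · exact absurd (h0 ▸ bot_le) hspec
  obtain ⟨w, hwK, hw⟩ := SetLike.not_le_iff_exists.1 hspec
  have := hK i
  have := hK (i + 1)
  have hnorm : (Subgroup.zpowers (φ w)).Normal := by
    rw [zpowers_normal_iff]
    intro g
    obtain ⟨g, rfl⟩ := hφ g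
    obtain ⟨k, hk⟩ := exists_conj_mul_zpow_inv_mem (hcyc i (by omega)).2 hwK g
    refine ⟨k, ?_⟩
    have h1 := hmin i (Nat.lt_succ_self i) hk
    rw [MonoidHom.mem_ker] at h1
    rw [← mul_inv_eq_one, ← h1]
    simp
  have hord : orderOf (φ w) ≠ 1 := fun h => hw (orderOf_eq_one_iff.1 h)
  refine ⟨φ w ^ (orderOf (φ w) / (orderOf (φ w)).minFac), ?_, zpowers_pow_normal hnorm _⟩
  rw [orderOf_pow_orderOf_div (orderOf_pos _).ne' (Nat.minFac_dvd _)]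
  exact Nat.minFac_prime hord

/-- Conjugation maps a nontrivial element to its powers modulo some normal subgroup that does not
contain it. -/
theorem IsSupersolvableGroup.exists_normal_conj (hG : IsSupersolvableGroup G) {z : G}
    (hz : z ≠ 1) : ∃ H : Subgroup G, H.Normal ∧ z ∉ H ∧
      ∀ g, ∃ k : ℤ, g * z * g⁻¹ * (z ^ k)⁻¹ ∈ H := by
  classical
  obtain ⟨n, K, hK, h0, hn, hcyc⟩ := hG
  -- The term just before the first one containing `z` is the required subgroup.
  have hex : ∃ i, z ∈ K i := ⟨n, hn ▸ Subgroup.mem_top z⟩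
  have hspec := Nat.find_spec hex
  have hmin : ∀ j < Nat.find hex, z ∉ K j := fun j hj => Nat.find_min hex hj
  have hle : Nat.find hex ≤ n := Nat.find_min' hex (hn ▸ Subgroup.mem_top z)
  generalize Nat.find hex = m at hspec hmin hle
  obtain _ | i := m
  · rw [h0, Subgroup.mem_bot] at hspec
    exact absurd hspec hz
  have := hK i
  have := hK (i + 1)
  exact ⟨K i, hK i, hmin i (Nat.lt_succ_self i),
    exists_conj_mul_zpow_inv_mem (hcyc i (by omega)).2 hspec⟩

/-- A subgroup of order twice an odd number, normal in `G`, contains a subgroup of index two that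
is normal in `G`. -/
theorem exists_normal_odd_of_card_two_mul [Finite G] (N : Subgroup G) (hN : N.Normal) (z : G)
    (hz : orderOf z = 2) (hzn : (Subgroup.zpowers z).Normal) (hzN : z ∈ N) {m : ℕ} (hm : Odd m)
    (hcard : Nat.card N = 2 * m) : ∃ K : Subgroup G, K.Normal ∧ K ≤ N ∧ Nat.card K = m := by
  let Z := (Subgroup.zpowers z).subgroupOf N
  have hZn : Z.Normal := Subgroup.Normal.subgroupOf hzn N
  have hZc : Nat.card Z = 2 := by
    rw [← hz, ← Nat.card_zpowers]
    exact Nat.card_congr (Subgroup.subgroupOfEquivOfLe (Subgroup.zpowers_le.2 hzN)).toEquiv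
  have hZi : Z.index = m := by
    have := Z.card_mul_index
    rw [hZc, hcard] at this
    exact Nat.eq_of_mul_eq_mul_left (by norm_num) this
  -- The Schur–Zassenhaus complement has index two in `N`, so it consists of exactly the elements of
  -- odd order, a set stable under conjugation in `G`.
  obtain ⟨L, hL⟩ := Subgroup.exists_right_complement'_of_coprime (N := Z)
    (by rw [hZc, hZi]; exact Nat.coprime_two_left.2 hm)
  have hLc : Nat.card L = m := by
    have := hL.card_mul_card
    rw [hZc, hcard] at this
    exact Nat.eq_of_mul_eq_mul_left (by norm_num) this
  have hLi : L.index = 2 := by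
    have := L.card_mul_index
    rw [hLc, hcard, mul_comm] at this
    exact Nat.eq_of_mul_eq_mul_right hm.pos this
  have hLmem : ∀ y : N, Odd (orderOf y) → y ∈ L := by
    intro y hy
    obtain ⟨k, hk⟩ := hy
    have h1 : y ^ (2 * k + 1) = 1 := by rw [← hk, pow_orderOf_eq_one]
    have h2 : y ^ (2 * k) ∈ L := by
      rw [mul_comm, pow_mul, pow_two]
      exact Subgroup.mul_self_mem_of_index_two hLi _
    have h3 : y = (y ^ (2 * k))⁻¹ := by
      rw [eq_inv_iff_mul_eq_one, ← pow_succ', h1]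
    rw [h3]
    exact inv_mem h2
  have hLodd : ∀ y ∈ L, Odd (orderOf y) := by
    intro y hy
    have : orderOf y ∣ Nat.card L := Subgroup.orderOf_dvd_natCard L hy
    rw [hLc] at this
    exact hm.of_dvd_nat this
  refine ⟨L.map N.subtype, ⟨fun w hw g => ?_⟩, Subgroup.map_subtype_le L, ?_⟩
  · obtain ⟨y, hy, rfl⟩ := hw
    have hmem : g * y * g⁻¹ ∈ N := hN.conj_mem y y.2 g
    refine ⟨⟨_, hmem⟩, hLmem _ ?_, rfl⟩
    have h1 : orderOf (⟨g * y * g⁻¹, hmem⟩ : N) = orderOf y := by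
      rw [← Subgroup.orderOf_coe, ← Subgroup.orderOf_coe y]
      exact (MulAut.conj g).orderOf_eq (y : G)
    rw [h1]
    exact hLodd y hy
  · rw [Subgroup.card_subtype, hLc]

/-- Induction over the finite quotients of a fixed group, so that one series serves throughout.
Modulo a normal subgroup of prime order a complement exists. Its preimage is a complement if the
prime is odd; if the prime is 2, its elements of odd order form one. -/
theorem exists_normal_two_complement_aux {G₀ : Type*} [Group G₀]
    (hG₀ : IsSupersolvableGroup G₀) (n : ℕ) :
    ∀ (S : Subgroup G₀) [S.Normal] [Finite (G₀ ⧸ S)], Nat.card (G₀ ⧸ S) = n →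
      ∃ N : Subgroup (G₀ ⧸ S), N.Normal ∧ Odd (Nat.card N) ∧ ∃ k, N.index = 2 ^ k := by
  induction n using Nat.strong_induction_on with
  | h n ih =>
    intro S _ _ hn
    rcases subsingleton_or_nontrivial (G₀ ⧸ S) with hs | hs
    · refine ⟨⊤, inferInstance, ?_, 0, by simp⟩
      rw [Subgroup.card_top, Nat.card_unique]
      exact odd_one
    obtain ⟨z, hzp, hzn⟩ := hG₀.exists_normal_zpowers (QuotientGroup.mk' S)
      (QuotientGroup.mk'_surjective S)
    let R := (Subgroup.zpowers z).comap (QuotientGroup.mk' S)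
    have hR : R.Normal := hzn.comap _
    let ψ : G₀ ⧸ S →* G₀ ⧸ R := QuotientGroup.map S R (MonoidHom.id G₀) fun g hg => by
      have : QuotientGroup.mk' S g = 1 := (QuotientGroup.eq_one_iff g).2 hg
      change QuotientGroup.mk' S g ∈ Subgroup.zpowers z
      rw [this]
      exact one_mem _
    have hψ : Function.Surjective ψ := by
      intro y
      obtain ⟨g, rfl⟩ := QuotientGroup.mk_surjective y
      exact ⟨QuotientGroup.mk g, rfl⟩
    have hker : ψ.ker = Subgroup.zpowers z := by
      ext y
      obtain ⟨g, rfl⟩ := QuotientGroup.mk_surjective y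
      exact QuotientGroup.eq_one_iff (N := R) g
    have hfin : Finite (G₀ ⧸ R) := Finite.of_surjective ψ hψ
    have hindex : Nat.card (G₀ ⧸ R) = (Subgroup.zpowers z).index := by
      rw [← hker, Subgroup.index_ker, MonoidHom.range_eq_top.2 hψ, Subgroup.card_top]
    have hcard := (Subgroup.zpowers z).card_mul_index
    rw [Nat.card_zpowers, ← hindex, hn] at hcard
    obtain ⟨N', hN', hodd, k, hk⟩ := ih (Nat.card (G₀ ⧸ R)) (by
      have := hzp.two_le
      have h0 : 0 < Nat.card (G₀ ⧸ R) := Nat.card_pos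
      nlinarith) R rfl
    let N := N'.comap ψ
    have hNn : N.Normal := hN'.comap ψ
    have hNi : N.index = 2 ^ k := by rw [← hk]; exact Subgroup.index_comap_of_surjective _ hψ
    have hNc : Nat.card N = orderOf z * Nat.card N' := by
      have h1 := N.card_mul_index
      have h2 := N'.card_mul_index
      rw [hNi, hn, ← hcard, ← h2, hk, ← mul_assoc] at h1
      exact Nat.eq_of_mul_eq_mul_right (by positivity) h1
    rcases hzp.eq_two_or_odd' with h2 | hzo
    · have hzN : z ∈ N := by
        change ψ z ∈ N'
        have : z ∈ ψ.ker := hker ▸ Subgroup.mem_zpowers z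
        rw [MonoidHom.mem_ker.1 this]
        exact one_mem _
      obtain ⟨K, hKn, hKN, hKc⟩ :=
        exists_normal_odd_of_card_two_mul N hNn z h2 hzn hzN hodd (by rw [hNc, h2])
      refine ⟨K, hKn, hKc ▸ hodd, k + 1, ?_⟩
      have h1 := K.card_mul_index
      have h3 := N.card_mul_index
      rw [hNi, hNc, h2] at h3
      rw [hKc, ← h3] at h1
      refine Nat.eq_of_mul_eq_mul_left hodd.pos (h1.trans ?_)
      ring
    · exact ⟨N, hNn, hNc ▸ hzo.mul hodd, k, hNi⟩

/-- Finite supersolvable groups have normal `2`-complements. -/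
theorem IsSupersolvableGroup.exists_normal_two_complement [Finite G]
    (hG : IsSupersolvableGroup G) :
    ∃ (N : Subgroup G) (_ : N.Normal), Odd (Nat.card N) ∧ IsPGroup 2 (G ⧸ N) := by
  obtain ⟨N', hN', hodd, k, hk⟩ := exists_normal_two_complement_aux hG _ (⊥ : Subgroup G) rfl
  have hsurj := QuotientGroup.mk'_surjective (⊥ : Subgroup G)
  have hinj : Function.Injective (QuotientGroup.mk' (⊥ : Subgroup G)) := by
    rw [← MonoidHom.ker_eq_bot_iff, QuotientGroup.ker_mk']
  have hi : (N'.comap (QuotientGroup.mk' (⊥ : Subgroup G))).index = 2 ^ k := by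
    rw [Subgroup.index_comap_of_surjective _ hsurj, hk]
  refine ⟨N'.comap (QuotientGroup.mk' ⊥), hN'.comap _, ?_, ?_⟩
  · have h1 := (N'.comap (QuotientGroup.mk' (⊥ : Subgroup G))).card_mul_index
    have h2 := N'.card_mul_index
    have h3 : Nat.card (G ⧸ (⊥ : Subgroup G)) = Nat.card G :=
      (Nat.card_congr (Equiv.ofBijective _ ⟨hinj, hsurj⟩)).symm
    rw [h3, ← h1, hi, hk] at h2
    rw [← Nat.eq_of_mul_eq_mul_right (by positivity) h2]
    exact hodd
  · exact IsPGroup.of_card (n := k) (by rw [← hi]; rfl)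

end Supersolvable

/-! ### From modular flows to integer flows -/

section IntegerFlow

variable {V E : Type*} [DecidableEq V] [Fintype E] {tail head : E → V}

/-- The net flow out of a vertex. -/
def netFlow (tail head : E → V) (φ : E → ℤ) (v : V) : ℤ :=
  ∑ e, φ e * ((if tail e = v then 1 else 0) - if head e = v then 1 else 0)

theorem netFlow_update [DecidableEq E] (φ : E → ℤ) (e : E) (z : ℤ) (v : V) :
    netFlow tail head (Function.update φ e z) v = netFlow tail head φ v +
      (z - φ e) * ((if tail e = v then 1 else 0) - if head e = v then 1 else 0) := by
  unfold netFlow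
  have h : ∀ e', Function.update φ e z e' = φ e' + if e' = e then z - φ e else 0 := by
    intro e'
    by_cases h : e' = e
    · subst h; simp
    · simp [h]
  simp only [h, add_mul, Finset.sum_add_distrib, ite_mul, zero_mul, Finset.sum_ite_eq',
    Finset.mem_univ, if_true]

theorem sum_netFlow (φ : E → ℤ) (S : Finset V) :
    ∑ v ∈ S, netFlow tail head φ v =
      ∑ e, φ e * ((if tail e ∈ S then 1 else 0) - if head e ∈ S then 1 else 0) := by
  unfold netFlow
  rw [Finset.sum_comm]
  refine Finset.sum_congr rfl fun e _ => ?_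
  rw [← Finset.mul_sum, Finset.sum_sub_distrib, Finset.sum_ite_eq, Finset.sum_ite_eq]

/-- Vertices joined by a directed path can exchange `k` units of net flow. -/
theorem exists_reroute {k : ℤ} (φ : E → ℤ) (hφ : ∀ e, φ e ≠ 0 ∧ |φ e| < k)
    (v : V) {w : V} (hw : Relation.ReflTransGen (fun a b => ∃ e,
      (0 < φ e ∧ tail e = a ∧ head e = b) ∨ (φ e < 0 ∧ head e = a ∧ tail e = b)) v w) :
    ∃ ψ : E → ℤ, (∀ e, ψ e ≠ 0 ∧ |ψ e| < k) ∧ ∀ u, netFlow tail head ψ u =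
      netFlow tail head φ u - (if v = u then k else 0) + if w = u then k else 0 := by
  classical
  let tgt : E → V := fun e => if 0 < φ e then head e else tail e
  let src : E → V := fun e => if 0 < φ e then tail e else head e
  -- Vertices reachable within `n` steps, edges being oriented along positive flow. The edge
  -- entering a new layer has not been altered before, so no edge is rerouted twice.
  let L : ℕ → Set V := fun n => Nat.rec {v} (fun _ S => S ∪ {b | ∃ e, src e ∈ S ∧ tgt e = b}) n
  have hL : ∀ n, L (n + 1) = L n ∪ {b | ∃ e, src e ∈ L n ∧ tgt e = b} := fun _ => rfl
  have hreach : ∃ n, w ∈ L n := by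
    induction hw with
    | refl => exact ⟨0, rfl⟩
    | tail _ h ih =>
      obtain ⟨n, hn⟩ := ih
      obtain ⟨e, ⟨h0, h1, h2⟩ | ⟨h0, h1, h2⟩⟩ := h
      · refine ⟨n + 1, ?_⟩
        rw [hL]
        refine Or.inr ⟨e, ?_, ?_⟩
        · simpa [src, h0, h1] using hn
        · simp [tgt, h0, h2]
      · refine ⟨n + 1, ?_⟩
        rw [hL]
        refine Or.inr ⟨e, ?_, ?_⟩
        · simpa [src, h0.not_gt, h1] using hn
        · simp [tgt, h0.not_gt, h2]
  have key : ∀ n, ∀ w ∈ L n, ∃ ψ : E → ℤ, (∀ e, ψ e ≠ 0 ∧ |ψ e| < k) ∧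
      (∀ e, tgt e ∉ L n → ψ e = φ e) ∧ ∀ u, netFlow tail head ψ u =
      netFlow tail head φ u - (if v = u then k else 0) + if w = u then k else 0 := by
    intro n
    induction n with
    | zero =>
      intro w hw
      obtain rfl : w = v := hw
      exact ⟨φ, hφ, fun _ _ => rfl, fun u => by ring⟩
    | succ n ih =>
      intro w hw
      rcases Classical.em (w ∈ L n) with hwn | hwn
      · obtain ⟨ψ, h1, h2, h3⟩ := ih w hwn
        refine ⟨ψ, h1, fun e he => h2 e fun h => he ?_, h3⟩
        rw [hL]
        exact Or.inl h
      · rw [hL] at hw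
        obtain ⟨e, he, rfl⟩ := hw.resolve_left hwn
        obtain ⟨ψ, h1, h2, h3⟩ := ih _ he
        have hψe := h2 e hwn
        have habs := abs_lt.1 (hφ e).2
        have hne := (hφ e).1
        refine ⟨Function.update ψ e (if 0 < φ e then φ e - k else φ e + k), fun e' => ?_,
          fun e' he' => ?_, fun u => ?_⟩
        · by_cases h : e' = e
          · subst h
            rw [Function.update_self, abs_lt]
            split_ifs with h0
            · exact ⟨by omega, by omega, by omega⟩
            · exact ⟨by omega, by omega, by omega⟩
          · rw [Function.update_of_ne h]
            exact h1 e'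
        · rw [hL, Set.mem_union, not_or] at he'
          have h : e' ≠ e := by
            rintro rfl
            exact he'.2 ⟨e', he, rfl⟩
          rw [Function.update_of_ne h]
          exact h2 e' he'.1
        · rw [netFlow_update, h3, hψe]
          by_cases h0 : 0 < φ e
          · simp only [src, tgt, h0, if_true]
            split_ifs <;> ring
          · simp only [src, tgt, h0, if_false]
            split_ifs <;> ring
  obtain ⟨n, hn⟩ := hreach
  obtain ⟨ψ, h1, -, h3⟩ := key n w hn
  exact ⟨ψ, h1, h3⟩

/-- Tutte: a nowhere-zero modular flow gives a nowhere-zero integer flow. -/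
theorem exists_integer_flow [Fintype V] {k : ℤ} (hk : 0 < k) (φ : E → ℤ)
    (hφ : ∀ e, φ e ≠ 0 ∧ |φ e| < k) (hdvd : ∀ v, k ∣ netFlow tail head φ v) :
    ∃ ψ : E → ℤ, (∀ e, ψ e ≠ 0 ∧ |ψ e| < k) ∧ ∀ v, netFlow tail head ψ v = 0 := by
  classical
  induction hN : ∑ v, (netFlow tail head φ v).natAbs using Nat.strong_induction_on
    generalizing φ with
  | h N ih =>
    by_cases hall : ∀ v, netFlow tail head φ v = 0
    · exact ⟨φ, hφ, hall⟩
    have htotal : ∑ v, netFlow tail head φ v = 0 := by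
      rw [sum_netFlow]
      simp
    obtain ⟨v, hv⟩ : ∃ v, 0 < netFlow tail head φ v := by
      by_contra hcon
      push Not at hcon
      exact hall fun v => (Finset.sum_eq_zero_iff_of_nonpos fun v _ => hcon v).1 htotal v
        (Finset.mem_univ v)
    let r : V → V → Prop := fun a b => ∃ e,
      (0 < φ e ∧ tail e = a ∧ head e = b) ∨ (φ e < 0 ∧ head e = a ∧ tail e = b)
    -- Otherwise the set reachable from `v` has positive total net outflow, although no edge carries
    -- flow out of it.
    obtain ⟨w, hvw, hw⟩ : ∃ w, Relation.ReflTransGen r v w ∧ netFlow tail head φ w < 0 := by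
      by_contra hcon
      push Not at hcon
      let S := Finset.univ.filter fun w => Relation.ReflTransGen r v w
      have h1 : 0 < ∑ w ∈ S, netFlow tail head φ w :=
        Finset.sum_pos' (fun w hw => hcon w (Finset.mem_filter.1 hw).2)
          ⟨v, Finset.mem_filter.2 ⟨Finset.mem_univ v, Relation.ReflTransGen.refl⟩, hv⟩
      rw [sum_netFlow] at h1
      refine h1.not_ge (Finset.sum_nonpos fun e _ => ?_)
      have hmem : ∀ a b, r a b → a ∈ S → b ∈ S := fun a b hab ha =>
        Finset.mem_filter.2 ⟨Finset.mem_univ b, (Finset.mem_filter.1 ha).2.tail hab⟩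
      rcases lt_or_gt_of_ne (hφ e).1 with h0 | h0
      · have := hmem (head e) (tail e) ⟨e, Or.inr ⟨h0, rfl, rfl⟩⟩
        split_ifs with h2 h3 h3
        · simp
        · simpa using h0.le
        · exact absurd (this h3) h2
        · simp
      · have := hmem (tail e) (head e) ⟨e, Or.inl ⟨h0, rfl, rfl⟩⟩
        split_ifs with h2 h3 h3
        · simp
        · exact absurd (this h2) h3
        · simpa using h0.le
        · simp
    have hne : v ≠ w := fun h => by rw [← h] at hw; omega
    obtain ⟨ψ, h1, h2⟩ := exists_reroute φ hφ v hvw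
    refine ih _ ?_ ψ h1 (fun u => ?_) rfl
    · rw [← hN]
      -- By divisibility the excesses at `v` and `w` are at least `k` in absolute value, so
      -- exchanging `k` units lowers the total.
      have hkv := Int.le_of_dvd hv (hdvd v)
      have hkw := Int.le_of_dvd (by omega) ((dvd_neg).2 (hdvd w))
      refine Finset.sum_lt_sum (fun u _ => ?_) ⟨v, Finset.mem_univ v, ?_⟩
      · rw [h2]
        split_ifs with h3 h4 h4
        · subst h3; omega
        · subst h3; omega
        · subst h4; omega
        · omega
      · rw [h2, if_pos rfl, if_neg hne.symm]
        omega
    · rw [h2]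
      refine ((hdvd u).sub ?_).add ?_
      · split_ifs <;> simp
      · split_ifs <;> simp

end IntegerFlow

/-! ### Flows in Cayley graphs -/

namespace ConnectionMultiset

variable {G : Type*} [Group G] [DecidableEq G] (X : ConnectionMultiset G)

/-- The labels of the arcs leaving a vertex of the Cayley graph. -/
def labels [Fintype G] : Finset (G × ℕ) :=
  (Finset.univ ×ˢ Finset.range X.elems.card).filter fun i => i.2 < X.elems.count i.1

theorem mem_labels [Fintype G] (i : G × ℕ) : i ∈ X.labels ↔ i.2 < X.elems.count i.1 := by
  simp only [labels, Finset.mem_filter, Finset.mem_product, Finset.mem_univ, Finset.mem_range,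
    true_and, and_iff_right_iff_imp]
  exact fun h => h.trans_le (Multiset.count_le_card _ _)

/-- The label of the reverse arc. -/
def reverseLabel {G : Type*} [Group G] (i : G × ℕ) : G × ℕ := (i.1⁻¹, i.2)

theorem reverseLabel_reverseLabel {G : Type*} [Group G] (i : G × ℕ) : reverseLabel (reverseLabel i) = i := by
  simp [reverseLabel]

theorem reverseLabel_mem [Fintype G] {i : G × ℕ} (hi : i ∈ X.labels) :
    reverseLabel i ∈ X.labels := by
  rw [mem_labels] at hi ⊢
  simpa [reverseLabel, X.count_inv] using hi

theorem fst_ne_one [Fintype G] {i : G × ℕ} (hi : i ∈ X.labels) : i.1 ≠ 1 := by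
  intro h
  rw [mem_labels, h, Multiset.count_eq_zero_of_notMem X.one_notMem] at hi
  exact absurd hi (Nat.not_lt_zero _)

/-- A chosen first end of an edge. -/
noncomputable def edgeTail (e : X.CayleyEdge) : G := (Quot.out e.1).1

/-- The second end of an edge. -/
noncomputable def edgeHead (e : X.CayleyEdge) : G := (Quot.out e.1).2

theorem isLink_edgeTail_edgeHead (e : X.CayleyEdge) :
    X.cayleyGraph.IsLink e (X.edgeTail e) (X.edgeHead e) :=
  (Quot.out_eq e.1).symm

theorem mem_edgeSet (e : X.CayleyEdge) : e ∈ X.cayleyGraph.edgeSet :=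
  (X.isLink_edgeTail_edgeHead e).edge_mem

theorem lt_count_of_isLink {e : X.CayleyEdge} {g h : G} (he : X.cayleyGraph.IsLink e g h) :
    (e.2 : ℕ) < X.elems.count (g⁻¹ * h) := by
  obtain ⟨p, i⟩ := e
  change p = s(g, h) at he
  subst he
  exact i.2

theorem ne_of_isLink {e : X.CayleyEdge} {g h : G} (he : X.cayleyGraph.IsLink e g h) : g ≠ h := by
  rintro rfl
  have := X.lt_count_of_isLink he
  rw [inv_mul_cancel, Multiset.count_eq_zero_of_notMem X.one_notMem] at this
  exact absurd this (Nat.not_lt_zero _)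

/-- The label at `v` of an edge incident with `v`. -/
noncomputable def edgeLabel (v : G) (e : X.CayleyEdge) : G × ℕ :=
  (v⁻¹ * (if X.edgeTail e = v then X.edgeHead e else X.edgeTail e), e.2)

theorem isLink_of_inc {v : G} {e : X.CayleyEdge} (he : X.edgeTail e = v ∨ X.edgeHead e = v) :
    X.cayleyGraph.IsLink e v (v * (X.edgeLabel v e).1) := by
  have h := X.isLink_edgeTail_edgeHead e
  simp only [edgeLabel, mul_inv_cancel_left]
  split_ifs with h1
  · rwa [h1] at h
  · rw [he.resolve_left h1] at h
    exact h.symm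

/-- This turns sums over the edges at `v` into sums over labels, so conservation can be read off
from `HasFlow`. -/
theorem bijOn_edgeLabel [Fintype G] (v : G) :
    Set.BijOn (X.edgeLabel v) {e | X.edgeTail e = v ∨ X.edgeHead e = v} X.labels := by
  refine ⟨fun e he => ?_, fun e he e' he' hee => ?_, fun i hi => ?_⟩
  · have := X.lt_count_of_isLink (X.isLink_of_inc he)
    rw [inv_mul_cancel_left] at this
    exact (X.mem_labels _).2 this
  · have h1 : e.1 = s(v, v * (X.edgeLabel v e).1) := X.isLink_of_inc he
    have h2 : e'.1 = s(v, v * (X.edgeLabel v e').1) := X.isLink_of_inc he'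
    have h3 : (e.2 : ℕ) = e'.2 := congrArg Prod.snd hee
    rw [hee, ← h2] at h1
    obtain ⟨p, j⟩ := e
    obtain ⟨p', j'⟩ := e'
    obtain rfl : p = p' := h1
    obtain rfl : j = j' := Fin.ext h3
    rfl
  · have hlt : i.2 < X.edgeMult s(v, v * i.1) := by
      have := (X.mem_labels i).1 hi
      change i.2 < X.elems.count (v⁻¹ * (v * i.1))
      rwa [inv_mul_cancel_left]
    let e : X.CayleyEdge := ⟨s(v, v * i.1), ⟨i.2, hlt⟩⟩
    have hl : X.cayleyGraph.IsLink e v (v * i.1) := rfl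
    have he : X.edgeTail e = v ∨ X.edgeHead e = v := by
      have h : s(v, v * i.1) = s(X.edgeTail e, X.edgeHead e) := X.isLink_edgeTail_edgeHead e
      rcases Sym2.eq_iff.1 h with h | h
      · exact Or.inl h.1.symm
      · exact Or.inr h.1.symm
    refine ⟨e, he, Prod.ext ?_ rfl⟩
    have h : s(v, v * i.1) = s(v, v * (X.edgeLabel v e).1) := X.isLink_of_inc he
    exact (mul_left_cancel (Sym2.congr_right.1 h)).symm

theorem card_labels [Fintype G] {k : ℕ} (h : X.cayleyGraph.IsRegularOfValency k) :
    X.labels.card = k := by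
  have h1 := h 1 (Set.mem_univ _)
  have h2 : X.cayleyGraph.loopSet 1 = ∅ := by
    ext e
    exact iff_of_false (fun he => X.ne_of_isLink he rfl) (Set.notMem_empty e)
  have h3 : X.cayleyGraph.incidenceSet 1 = {e | X.edgeTail e = 1 ∨ X.edgeHead e = 1} := by
    ext e
    rw [Graph.mem_incidenceSet]
    have hl := X.isLink_edgeTail_edgeHead e
    constructor
    · intro he
      rcases he.eq_or_eq_of_isLink hl with h | h
      · exact Or.inl h.symm
      · exact Or.inr h.symm
    · rintro (h | h)
      · exact h ▸ hl.inc_left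
      · exact h ▸ hl.inc_right
  have hb := X.bijOn_edgeLabel 1
  rw [Graph.valency, h2, Set.ncard_empty, add_zero, h3, ← hb.injOn.ncard_image,
    hb.image_eq, Set.ncard_coe_finset] at h1
  exact h1

/-- A walk from `1` to `g` writes `g` as a product of labels. -/
theorem closure_labels [Fintype G] (h : X.cayleyGraph.IsConnected) :
    Subgroup.closure (Prod.fst '' (X.labels : Set (G × ℕ))) = ⊤ := by
  rw [eq_top_iff]
  rintro g -
  have hg := h.2 1 (Set.mem_univ _) g (Set.mem_univ _)
  induction hg with
  | refl => exact one_mem _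
  | tail _ hadj ih =>
    rename_i b c _
    obtain ⟨e, he⟩ := hadj
    have h1 := X.lt_count_of_isLink he
    have h2 : b⁻¹ * c ∈ Subgroup.closure (Prod.fst '' (X.labels : Set (G × ℕ))) :=
      Subgroup.subset_closure ⟨(b⁻¹ * c, e.2), (X.mem_labels _).2 h1, rfl⟩
    have := mul_mem ih h2
    rwa [mul_inv_cancel_left] at this

/-- Each edge takes the value of its arc at the chosen tail, lifted to `1` or `-1`. Antisymmetry
gives the contribution at the head, so the net flow is divisible by 3 and Tutte's theorem applies.
-/
theorem admitsNowhereZeroFlow_of_hasFlow [Finite G] [Fintype G]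
    (h : HasFlow Prod.fst (reverseLabel (G := G)) X.labels) :
    X.cayleyGraph.AdmitsNowhereZeroFlow 3 := by
  classical
  obtain ⟨f, hf0, hf1, hf2⟩ := h
  have := Fintype.ofFinite X.cayleyGraph.edgeSet
  let D : X.cayleyGraph.Orientation :=
    { tail := fun e => X.edgeTail e
      head := fun e => X.edgeHead e
      isLink := fun e => X.isLink_edgeTail_edgeHead e }
  let lift : ZMod 3 → ℤ := fun z => if z = 1 then 1 else -1
  have lift_cast : ∀ z : ZMod 3, z ≠ 0 → ((lift z : ℤ) : ZMod 3) = z := by decide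
  have lift_bound : ∀ z, lift z ≠ 0 ∧ |lift z| < 3 := by decide
  let arc : X.CayleyEdge → G × ℕ := fun e => ((X.edgeTail e)⁻¹ * X.edgeHead e, e.2)
  have harc : ∀ e, arc e ∈ X.labels := fun e =>
    (X.mem_labels _).2 (X.lt_count_of_isLink (X.isLink_edgeTail_edgeHead e))
  let φ : X.cayleyGraph.edgeSet → ℤ := fun e => lift (f (X.edgeTail e) (arc e))
  have hφ : ∀ e, ((φ e : ℤ) : ZMod 3) = f (X.edgeTail e) (arc e) := fun e =>
    lift_cast _ (hf0 _ _ (harc e))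
  have hdvd : ∀ v, (3 : ℤ) ∣ netFlow D.tail D.head φ v := by
    intro v
    refine (ZMod.intCast_zmod_eq_zero_iff_dvd _ 3).1 ?_
    rw [← hf2 v, netFlow]
    push_cast
    rw [← Finset.sum_filter_add_sum_filter_not Finset.univ
      fun e : X.cayleyGraph.edgeSet => X.edgeTail e = v ∨ X.edgeHead e = v]
    rw [Finset.sum_eq_zero (s := Finset.univ.filter
      fun e : X.cayleyGraph.edgeSet => ¬ (X.edgeTail e = v ∨ X.edgeHead e = v)), add_zero]
    · have hb := X.bijOn_edgeLabel v
      refine Finset.sum_nbij (fun e => X.edgeLabel v e) (fun e he => ?_) (fun e he e' he' hee => ?_)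
        (fun i hi => ?_) fun e he => ?_
      · exact hb.mapsTo (Finset.mem_filter.1 he).2
      · exact Subtype.ext (hb.injOn (Finset.mem_filter.1 he).2 (Finset.mem_filter.1 he').2 hee)
      · obtain ⟨e, he, rfl⟩ := hb.surjOn hi
        exact ⟨⟨e, X.mem_edgeSet e⟩, Finset.mem_filter.2 ⟨Finset.mem_univ _, he⟩, rfl⟩
      · have hne := X.ne_of_isLink (X.isLink_edgeTail_edgeHead e)
        rw [hφ]
        by_cases h1 : X.edgeTail e = v
        · have h2 : X.edgeHead e ≠ v := fun h => hne (h1.trans h.symm)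
          simp [D, h1, h2, arc, edgeLabel]
        · have h2 : X.edgeHead e = v := (Finset.mem_filter.1 he).2.resolve_left h1
          have h3 := hf1 (X.edgeTail e) (arc e) (harc e)
          have h4 : X.edgeTail e * (arc e).1 = v := by simp [arc, h2]
          have h5 : reverseLabel (arc e) = X.edgeLabel v e := by
            simp [arc, edgeLabel, reverseLabel, h1, h2]
          rw [h4, h5] at h3
          rw [h3]
          simp [D, h1, h2]
    · intro e he
      have h1 := (Finset.mem_filter.1 he).2
      rw [not_or] at h1
      simp [D, h1.1, h1.2]
  obtain ⟨ψ, h1, h2⟩ := exists_integer_flow (by norm_num) φ (fun e => lift_bound _) hdvd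
  refine ⟨D, ψ, ⟨fun e => (h1 e).2, fun v _ => ?_⟩, fun e => (h1 e).1⟩
  have h3 : ∀ p : X.cayleyGraph.edgeSet → G, ∑ᶠ e ∈ {e | p e = v}, ψ e =
      ∑ e, if p e = v then ψ e else 0 := by
    intro p
    rw [← Finset.sum_filter, ← finsum_mem_coe_finset]
    simp
  rw [h3, h3, ← sub_eq_zero, ← Finset.sum_sub_distrib]
  refine Eq.trans ?_ (h2 v)
  refine Finset.sum_congr rfl fun e _ => ?_
  rw [mul_sub, mul_ite, mul_ite, mul_one, mul_zero]

end ConnectionMultiset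

/-! ### The main theorem -/

theorem theorem1 {G : Type*} [Group G] [Finite G] [DecidableEq G]
    (hG : IsSupersolvableGroup G)
    (P : Sylow 2 G) (hP : ¬ IsCyclic P)
    (X : ConnectionMultiset G) (hconn : X.cayleyGraph.IsConnected)
    (k : ℕ) (hk : 4 ≤ k) (hval : X.cayleyGraph.IsRegularOfValency k) :
    X.cayleyGraph.AdmitsNowhereZeroFlow 3 := by
  have := Fintype.ofFinite G
  refine X.admitsNowhereZeroFlow_of_hasFlow ?_
  obtain ⟨N, hN, hodd, htwo⟩ := hG.exists_normal_two_complement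
  let φ := QuotientGroup.mk' N
  have hsurj : Function.Surjective φ := QuotientGroup.mk'_surjective N
  have hker : ∀ g, φ g = 1 → Odd (orderOf g) := fun g hg =>
    hodd.of_dvd_nat (Subgroup.orderOf_dvd_natCard N ((QuotientGroup.eq_one_iff g).1 hg))
  have hcyc : ¬ IsCyclic (G ⧸ N) := by
    intro h
    -- The Sylow subgroup meets the odd-order subgroup `N` trivially, so it embeds in the quotient.
    refine hP (isCyclic_of_injective (φ.comp (P : Subgroup G).subtype) ?_)
    rw [injective_iff_map_eq_one]
    intro g hg
    obtain ⟨m, hm⟩ := P.isPGroup' g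
    have h1 : orderOf (g : G) ∣ 2 ^ m := by
      rw [orderOf_dvd_iff_pow_eq_one, ← Subgroup.coe_pow, hm, Subgroup.coe_one]
    have h2 := (Nat.Coprime.pow_right m (Nat.coprime_two_right.2 (hker g hg))).eq_one_of_dvd h1
    exact Subtype.ext (orderOf_eq_one_iff.1 h2)
  have hfix1 : ∀ i ∈ X.labels, ConnectionMultiset.reverseLabel i = i → i.1 * i.1 = 1 := by
    intro i _ h
    have h1 : i.1⁻¹ = i.1 := congrArg Prod.fst h
    rw [← eq_inv_iff_mul_eq_one, h1]
  have hfix : ∀ i ∈ X.labels, ConnectionMultiset.reverseLabel i = i → φ i.1 ≠ 1 := by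
    intro i hi h h1
    have h2 : orderOf i.1 ∣ 2 := by
      rw [orderOf_dvd_iff_pow_eq_one, pow_two, hfix1 i hi h]
    have h3 := (Nat.coprime_two_right.2 (hker _ h1)).eq_one_of_dvd h2
    exact X.fst_ne_one hi (orderOf_eq_one_iff.1 h3)
  have hgen : Subgroup.closure ((fun i : G × ℕ => φ i.1) '' X.labels) = ⊤ := by
    have h1 := congrArg (Subgroup.map φ) (X.closure_labels hconn)
    rw [MonoidHom.map_closure, Set.image_image, ← MonoidHom.range_eq_map,
      MonoidHom.range_eq_top.2 hsurj] at h1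
    exact h1
  have hrev : ∀ i ∈ X.labels, ConnectionMultiset.reverseLabel i ∈ X.labels := fun i hi =>
    X.reverseLabel_mem hi
  have hrr : ∀ i ∈ X.labels,
      ConnectionMultiset.reverseLabel (ConnectionMultiset.reverseLabel i) = i := fun i _ =>
    ConnectionMultiset.reverseLabel_reverseLabel i
  rcases HasFlow.or_exceptional (x := Prod.fst) htwo hcyc φ hrev hrr (fun i _ => rfl) hfix hgen
    with h | ⟨a, b, c, hab, hac, hbc, hF, hz, htriv⟩
  · exact h
  have hmem : ∀ i, i = a ∨ i = b ∨ i = c →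
      i ∈ X.labels ∧ ConnectionMultiset.reverseLabel i = i := by
    intro i hi
    have h1 : i ∈ ({a, b, c} : Finset (G × ℕ)) := by simpa using hi
    rw [← hF] at h1
    simpa only [Finset.mem_filter] using h1
  obtain ⟨ha, ha'⟩ := hmem a (by simp)
  obtain ⟨hb, hb'⟩ := hmem b (by simp)
  obtain ⟨hc, hc'⟩ := hmem c (by simp)
  -- Only three labels are involutory, so valency at least four forces another one.
  obtain ⟨d, hd, hd'⟩ : ∃ d ∈ X.labels, ConnectionMultiset.reverseLabel d ≠ d := by
    by_contra hcon
    push Not at hcon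
    have h1 := congrArg Finset.card hF
    rw [Finset.filter_true_of_mem hcon, X.card_labels hval,
      Finset.card_eq_three.2 ⟨a, b, c, hab, hac, hbc, rfl⟩] at h1
    omega
  obtain ⟨H, hH, hdH, hconj⟩ := hG.exists_normal_conj (X.fst_ne_one hd)
  have hflow : HasFlow Prod.fst ConnectionMultiset.reverseLabel
      {a, b, c, d, ConnectionMultiset.reverseLabel d} :=
    HasFlow.of_normal_cyclic htwo φ hker hab hac hbc ha' hb' hc' hd' (hrr d hd) rfl
      (hfix1 a ha ha') (hfix1 b hb hb') (hfix1 c hc hc') (hfix a ha ha') (hfix b hb hb')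
      (hfix c hc hc') hz (htriv d hd hd') H hdH hconj
  -- The block uses all the involutory labels, so only inverse pairs remain.
  refine HasFlow.extend htwo φ hrev hrr (fun i _ => rfl) hfix (fun i hi => ?_) (fun i hi => ?_)
    hflow ?_
  · simp only [Finset.mem_insert, Finset.mem_singleton] at hi
    rcases hi with rfl | rfl | rfl | rfl | rfl
    exacts [ha, hb, hc, hd, hrev _ hd]
  · simp only [Finset.mem_insert, Finset.mem_singleton] at hi ⊢
    rcases hi with rfl | rfl | rfl | rfl | rfl
    · simp [ha']
    · simp [hb']
    · simp [hc']
    · simp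
    · simp [hrr _ hd]
  · rw [Finset.filter_eq_empty_iff.2]
    · simp
    · intro i hi hii
      rw [Finset.mem_sdiff] at hi
      have h1 : i ∈ ({a, b, c} : Finset (G × ℕ)) := hF ▸ Finset.mem_filter.2 ⟨hi.1, hii⟩
      simp only [Finset.mem_insert, Finset.mem_singleton] at h1
      refine hi.2 ?_
      simp only [Finset.mem_insert, Finset.mem_singleton]
      tauto
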